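/- Let $N\ge 3$ be an integer, let $\Omega\subseteq\mathbb R^N$ be an open set (bounded or unbounded) with $0\in\Omega$, let $\bar\mu=\left(\frac{N-2}{2}\right)^2$, let $0<\mu<\bar\mu$ and put $\nu=\sqrt{\bar\mu}-\sqrt{\bar\mu-\mu}$. Let $p\ge\frac{N+2}{N-2}$ and $q>\max\left\{p,\frac{2+\nu}{\nu}\right\}$ be real numbers. Let $u\in H^1_0(\Omega)\cap L^{q+1}(\Omega)$ with $u>0$ almost everywhere in $\Omega$ be a weak solution of $$-\Delta u-\mu\frac{u}{|x|^2}=u^p-u^q\quad\text{in }\Omega,$$ that is, $$\int_\Omega\nabla u\cdot\nabla\varphi\,dx-\mu\int_\Omega\frac{u\,\varphi}{|x|^2}\,dx=\int_\Omega(u^p-u^q)\,\varphi\,dx\qquad\text{for all }\varphi\in C_c^\infty(\Omega).$$ Then there are constants $C>0$ and $R>0$ (which may depend on $u$) with $B_R(0)\subseteq\Omega$ such that $$u(x)\ge C|x|^{-\frac{2}{q-1}}$$ for almost every $x\in B_R(0)$; moreover, if $w$ is any function equal to $u$ almost everywhere in $\Omega$, then $w(x)\ge C|x|^{-\frac{2}{q-1}}$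 holds, with the same $C$ and $R$, at every point $x\in B_R(0)\setminus\{0\}$ at which $w$ is continuous. In particular, a representative of $u$ that is continuous on $\Omega\setminus\{0\}$ satisfies the inequality at every $x\in B_R(0)\setminus\{0\}$. -/

import Mathlib

open MeasureTheory Filter Topology
open scoped Distributions

noncomputable section

/-- The Hardy constant `((N - 2) / 2) ^ 2`. -/
def hardyConst (N : ℕ) : ℝ := (((N : ℝ) - 2) / 2) ^ 2

/-- The smaller root `ν = √μ̄ - √(μ̄ - μ)` of `t ^ 2 - (N - 2) t + μ = 0`, with `μ̄` the Hardy
constant. -/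
def hardyExp (N : ℕ) (μ : ℝ) : ℝ := √(hardyConst N) - √(hardyConst N - μ)

/-- `G` is the distributional gradient of `u` in the open set `Ω`. -/
def HasWeakGradient {N : ℕ} (Ω : TopologicalSpace.Opens (EuclideanSpace ℝ (Fin N)))
    (u : EuclideanSpace ℝ (Fin N) → ℝ)
    (G : EuclideanSpace ℝ (Fin N) → EuclideanSpace ℝ (Fin N)) : Prop :=
  LocallyIntegrableOn u (Ω : Set (EuclideanSpace ℝ (Fin N))) ∧
  LocallyIntegrableOn G (Ω : Set (EuclideanSpace ℝ (Fin N))) ∧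
  ∀ φ : 𝓓(Ω, ℝ),
    ∫ x in (Ω : Set (EuclideanSpace ℝ (Fin N))), u x • gradient φ x =
      -∫ x in (Ω : Set (EuclideanSpace ℝ (Fin N))), φ x • G x

/-- `u` belongs to the Sobolev space `H¹(Ω)` and `G` is its weak gradient. -/
def MemH1 {N : ℕ} (Ω : TopologicalSpace.Opens (EuclideanSpace ℝ (Fin N)))
    (u : EuclideanSpace ℝ (Fin N) → ℝ)
    (G : EuclideanSpace ℝ (Fin N) → EuclideanSpace ℝ (Fin N)) : Prop :=
  MemLp u 2 (volume.restrict (Ω : Set (EuclideanSpace ℝ (Fin N)))) ∧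
  MemLp G 2 (volume.restrict (Ω : Set (EuclideanSpace ℝ (Fin N)))) ∧
  HasWeakGradient Ω u G

/-- `u` belongs to `H¹₀(Ω)`, the closure of the test functions in `H¹(Ω)`, and `G` is its weak
gradient. -/
def MemH1Zero {N : ℕ} (Ω : TopologicalSpace.Opens (EuclideanSpace ℝ (Fin N)))
    (u : EuclideanSpace ℝ (Fin N) → ℝ)
    (G : EuclideanSpace ℝ (Fin N) → EuclideanSpace ℝ (Fin N)) : Prop :=
  MemH1 Ω u G ∧
  ∃ φ : ℕ → 𝓓(Ω, ℝ),
    Tendsto (fun n => eLpNorm (fun x => u x - φ n x) 2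
      (volume.restrict (Ω : Set (EuclideanSpace ℝ (Fin N))))) atTop (𝓝 0) ∧
    Tendsto (fun n => eLpNorm (fun x => G x - gradient (φ n) x) 2
      (volume.restrict (Ω : Set (EuclideanSpace ℝ (Fin N))))) atTop (𝓝 0)

/-- `u` is a weak solution of `-Δu - μ u / |x|² = u ^ p - u ^ q`, `u > 0` in `Ω`,
`u ∈ H¹₀(Ω) ∩ L^{q+1}(Ω)`. -/
def IsPositiveWeakSolution {N : ℕ} (Ω : TopologicalSpace.Opens (EuclideanSpace ℝ (Fin N)))
    (μ p q : ℝ) (u : EuclideanSpace ℝ (Fin N) → ℝ) : Prop :=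
  (∀ᵐ x ∂volume.restrict (Ω : Set (EuclideanSpace ℝ (Fin N))), 0 < u x) ∧
  MemLp u (ENNReal.ofReal (q + 1)) (volume.restrict (Ω : Set (EuclideanSpace ℝ (Fin N)))) ∧
  ∃ G : EuclideanSpace ℝ (Fin N) → EuclideanSpace ℝ (Fin N),
    MemH1Zero Ω u G ∧
    ∀ φ : 𝓓(Ω, ℝ),
      (∫ x in (Ω : Set (EuclideanSpace ℝ (Fin N))), inner ℝ (G x) (gradient φ x)) -
          μ * ∫ x in (Ω : Set (EuclideanSpace ℝ (Fin N))), u x * φ x / ‖x‖ ^ 2 =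
        ∫ x in (Ω : Set (EuclideanSpace ℝ (Fin N))), (u x ^ p - u x ^ q) * φ x

end

/-!
Write `α = 2 / (q - 1)`, `ν = hardyExp N μ`. The hypothesis on `q` says `α < ν`, and since
`t ↦ t (N - 2 - t)` increases up to `(N - 2) / 2 ≥ ν` and takes the value `μ` at `ν`, the function
`C |x|^(-α)` with `C` small satisfies `-Δw - μ w / |x|² + w^q < 0`, whereas the solution satisfies
`-Δu - μ u / |x|² + u^q = u^p ≥ 0`. The claim is the comparison `w ≤ u`, and three points make it
work.

* *Boundary values.* Where `u < 1` one has `u^p ≥ u^q`, so a smooth concave truncation of `u` is a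
  positive weakly superharmonic function on `Ω \ {0}`
  (`IsWeakPoissonSolution.integral_truncation_le`). For such a function the averages
  `r^(-N) ∫ v(x) h(|x - x₀|² / r²) dx` decrease in `r`, because the `r`-derivative of the kernel is
  a positive multiple of the Laplacian of a nonnegative bump. Comparing with the limit `r → 0` at
  Lebesgue points bounds `u` from below by a positive constant on each compact subset of
  `Ω \ {0}` (`IsWeakPoissonSolution.exists_pos_le`), in particular on a spherical shell.
* *The singularity.* The comparison is made with `C |x|^(-α) - ε |x|^(-ν)`, which is negative near
  the origin since `α < ν`, while `|x|^(-ν)` is annihilated by `-Δ - μ / |x|²`. Hence every test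
  function is supported away from the origin, and `ε → 0` at the end
  (`IsWeakPoissonSolution.ae_radialBarrier_le`).
* *Hardy's inequality.* With `z = w - u`, a bump-like profile `b` vanishing on `(-∞, 0]`, and the
  primitives `P` of `b` and `T` of `b²`, the equation is tested with `ζ T(z)`; the resulting
  term `∫ ζ b(z)² |∇z|² = ∫ ζ |∇P(z)|²` is at least `((N - 2) / 2)² ∫ ζ P(z)² / |x|²`, which is
  proved by integrating the square `|∇P(z) + (N - 2) / 2 · P(z) x / |x|²|²`. Because `w` is a
  strict subsolution, `b` can be chosen so that what is left has a negative integrand wherever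
  `z > 0` (`exists_hardy_profile`, `IsWeakPoissonSolution.ae_le_of_subsolution`).

All test functions are built from the smooth functions that approximate `u` in `H¹`, by composition
and multiplication with smooth functions; neither mollification nor a Sobolev chain rule is used.
-/

open scoped ContDiff Gradient InnerProductSpace

/-! ### Smooth approximation and gradients -/

/-- The Euclidean space `ℝᴺ`. -/
abbrev Euc (N : ℕ) : Type := EuclideanSpace ℝ (Fin N)

variable {N : ℕ}

theorem integrable_inner_of_memLp_two {X F : Type*} [MeasurableSpace X] {m : Measure X}
    [NormedAddCommGroup F] [InnerProductSpace ℝ F] {V G : X → F}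
    (hV : MemLp V 2 m) (hG : MemLp G 2 m) : Integrable (fun x => ⟪V x, G x⟫_ℝ) m :=
  (hV.norm.integrable_mul hG.norm).mono' (hV.aestronglyMeasurable.inner hG.aestronglyMeasurable)
    (Eventually.of_forall fun _ => norm_inner_le_norm _ _)

/-- Dominated convergence for bounded multipliers of a fixed integrable function. -/
theorem tendsto_integral_bdd_mul {X : Type*} [MeasurableSpace X] {m : Measure X}
    {a : ℕ → X → ℝ} {b f : X → ℝ} {M : ℝ}
    (ha : ∀ n, AEStronglyMeasurable (a n) m) (haM : ∀ n x, |a n x| ≤ M)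
    (hab : ∀ᵐ x ∂m, Tendsto (fun n => a n x) atTop (𝓝 (b x))) (hf : Integrable f m) :
    Tendsto (fun n => ∫ x, a n x * f x ∂m) atTop (𝓝 (∫ x, b x * f x ∂m)) := by
  refine tendsto_integral_of_dominated_convergence (fun x => M * |f x|)
    (fun n => (ha n).mul hf.aestronglyMeasurable) (hf.abs.const_mul M) ?_ ?_
  · intro n
    refine Eventually.of_forall fun x => ?_
    rw [Real.norm_eq_abs, abs_mul]
    exact mul_le_mul_of_nonneg_right (haM n x) (abs_nonneg _)
  · filter_upwards [hab] with x hx using hx.mul_const _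

/-- The integrals of `aₙ ⟪V, Hₙ⟫` converge if the multipliers `aₙ` are bounded and converge almost
everywhere while `Hₙ` converges in `L²`. -/
theorem tendsto_integral_bdd_mul_inner {X F : Type*} [MeasurableSpace X] {m : Measure X}
    [NormedAddCommGroup F] [InnerProductSpace ℝ F]
    {a : ℕ → X → ℝ} {b : X → ℝ} {V G : X → F} {H : ℕ → X → F} {M : ℝ} (hM : 0 ≤ M)
    (ha : ∀ n, AEStronglyMeasurable (a n) m) (haM : ∀ n x, |a n x| ≤ M)
    (hab : ∀ᵐ x ∂m, Tendsto (fun n => a n x) atTop (𝓝 (b x)))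
    (hV : MemLp V 2 m) (hG : MemLp G 2 m) (hH : ∀ n, AEStronglyMeasurable (H n) m)
    (hlim : Tendsto (fun n => eLpNorm (fun x => G x - H n x) 2 m) atTop (𝓝 0)) :
    Tendsto (fun n => ∫ x, a n x * ⟪V x, H n x⟫_ℝ ∂m) atTop (𝓝 (∫ x, b x * ⟪V x, G x⟫_ℝ ∂m)) := by
  have hVG : Integrable (fun x => ⟪V x, G x⟫_ℝ) m := integrable_inner_of_memLp_two hV hG
  have h1 : Tendsto (fun n => ∫ x, a n x * ⟪V x, G x⟫_ℝ ∂m) atTop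
      (𝓝 (∫ x, b x * ⟪V x, G x⟫_ℝ ∂m)) := tendsto_integral_bdd_mul ha haM hab hVG
  have hev : ∀ᶠ n in atTop, MemLp (fun x => G x - H n x) 2 m := by
    filter_upwards [hlim.eventually (gt_mem_nhds (show (0 : ENNReal) < 1 by simp))] with n hn
    exact ⟨hG.aestronglyMeasurable.sub (hH n), hn.trans (by simp)⟩
  have h2 : Tendsto (fun n => ∫ x, a n x * ⟪V x, G x - H n x⟫_ℝ ∂m) atTop (𝓝 0) := by
    have hlim' : Tendsto (fun n => M * (eLpNorm V 2 m).toReal *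
        (eLpNorm (fun x => G x - H n x) 2 m).toReal) atTop (𝓝 0) := by
      have := (ENNReal.tendsto_toReal (ENNReal.zero_ne_top)).comp hlim
      simpa using this.const_mul (M * (eLpNorm V 2 m).toReal)
    refine squeeze_zero_norm' ?_ hlim'
    filter_upwards [hev] with n hn
    have e1 : ‖∫ x, a n x * ⟪V x, G x - H n x⟫_ℝ ∂m‖ ≤
        ∫ x, M * (‖V x‖ * ‖G x - H n x‖) ∂m := by
      refine norm_integral_le_of_norm_le ((hV.norm.integrable_mul hn.norm).const_mul M) ?_
      refine Eventually.of_forall fun x => ?_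
      rw [Real.norm_eq_abs, abs_mul]
      exact mul_le_mul (haM n x) (abs_real_inner_le_norm _ _) (abs_nonneg _)
        ((abs_nonneg _).trans (haM n x))
    rw [integral_const_mul] at e1
    refine e1.trans ((mul_le_mul_of_nonneg_left ?_ hM).trans_eq (mul_assoc _ _ _).symm)
    have := integral_mul_norm_le_Lp_mul_Lq (μ := m) (f := V) (g := fun x => G x - H n x)
        (p := 2) (q := 2) Real.HolderConjugate.two_two (by simpa using hV) (by simpa using hn)
    refine this.trans (le_of_eq ?_)
    rw [hV.eLpNorm_eq_integral_rpow_norm (by simp) (by simp),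
        hn.eLpNorm_eq_integral_rpow_norm (by simp) (by simp),
        ENNReal.toReal_ofReal (by positivity), ENNReal.toReal_ofReal (by positivity)]
    simp
  have h3 := h1.sub h2
  rw [sub_zero] at h3
  refine h3.congr' ?_
  filter_upwards [hev] with n hn
  rw [← integral_sub]
  · refine integral_congr_ae (Eventually.of_forall fun x => ?_)
    simp only [inner_sub_right]; ring
  · exact hVG.bdd_mul (ha n) (Eventually.of_forall (haM n))
  · exact (integrable_inner_of_memLp_two hV hn).bdd_mul (ha n) (Eventually.of_forall (haM n))

/-- `φ` is a sequence of smooth functions approximating `u` almost everywhere in `Ω`, with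
gradients converging to `G` in `L²(Ω)`. -/
structure IsSmoothApprox {N : ℕ} (Ω : TopologicalSpace.Opens (Euc N)) (u : Euc N → ℝ)
    (G : Euc N → Euc N) (φ : ℕ → Euc N → ℝ) : Prop where
  contDiff : ∀ n, ContDiff ℝ ∞ (φ n)
  ae_tendsto : ∀ᵐ x ∂volume.restrict (Ω : Set (Euc N)),
    Tendsto (fun n => φ n x) atTop (𝓝 (u x))
  memLp : MemLp G 2 (volume.restrict (Ω : Set (Euc N)))
  tendsto_gradient : Tendsto (fun n => eLpNorm (fun x => G x - ∇ (φ n) x) 2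
      (volume.restrict (Ω : Set (Euc N)))) atTop (𝓝 0)

/-- A subsequence of the test functions in the definition of `H¹₀` also converges almost
everywhere. -/
theorem MemH1Zero.exists_isSmoothApprox {N : ℕ} {Ω : TopologicalSpace.Opens (Euc N)}
    {u : Euc N → ℝ} {G : Euc N → Euc N} (h : MemH1Zero Ω u G) :
    ∃ φ, IsSmoothApprox Ω u G φ := by
  obtain ⟨⟨hu, hG, -⟩, φ, h1, h2⟩ := h
  have hm : TendstoInMeasure (volume.restrict (Ω : Set (Euc N))) (fun n => (φ n : Euc N → ℝ))
      atTop u := by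
    refine tendstoInMeasure_of_tendsto_eLpNorm (p := 2) (by simp)
      (fun n => (φ n).continuous.aestronglyMeasurable) hu.aestronglyMeasurable ?_
    refine h1.congr fun n => ?_
    rw [eLpNorm_sub_comm]
    rfl
  obtain ⟨ns, hns, hae⟩ := hm.exists_seq_tendsto_ae
  exact ⟨fun n => φ (ns n), fun n => (φ (ns n)).contDiff, hae, hG, h2.comp hns.tendsto_atTop⟩


theorem continuous_gradient {f : Euc N → ℝ} (hf : ContDiff ℝ ∞ f) : Continuous (∇ f) :=
  (InnerProductSpace.toDual ℝ (Euc N)).symm.continuous.comp (hf.continuous_fderiv (by simp))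

theorem gradient_mul_comp_sub {ζ w φ : Euc N → ℝ} {T : ℝ → ℝ} {x : Euc N}
    (hζ : DifferentiableAt ℝ ζ x) (hw : DifferentiableAt ℝ w x) (hφ : DifferentiableAt ℝ φ x)
    (hT : Differentiable ℝ T) :
    ∇ (fun x => ζ x * T (w x - φ x)) x =
      T (w x - φ x) • ∇ ζ x + (ζ x * deriv T (w x - φ x)) • (∇ w x - ∇ φ x) := by
  have h1 : HasFDerivAt (fun x => T (w x - φ x))
      (deriv T (w x - φ x) • (fderiv ℝ w x - fderiv ℝ φ x)) x :=
    (hT _).hasDerivAt.comp_hasFDerivAt x (hw.hasFDerivAt.sub hφ.hasFDerivAt)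
  refine ext_inner_right ℝ fun v => ?_
  have h2 : HasFDerivAt (fun x => ζ x * T (w x - φ x)) _ x := hζ.hasFDerivAt.mul h1
  rw [inner_gradient_left, h2.fderiv]
  simp only [add_apply, smul_apply, sub_apply, smul_eq_mul, inner_add_left,
    inner_smul_left, inner_sub_left,
    inner_gradient_left]
  simp
  ring

theorem gradient_eq_zero_of_notMem_tsupport (f : Euc N → ℝ) {x : Euc N} (hx : x ∉ tsupport f) :
    ∇ f x = 0 := by
  have : f =ᶠ[𝓝 x] fun _ => 0 := notMem_tsupport_iff_eventuallyEq.1 hx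
  rw [gradient, this.fderiv_eq]
  simp

/-! ### Testing the equation with functions of the solution -/

/-- `u` solves `-Δu = g` weakly in the open set `U`, with weak gradient `G` in `L²(U)`. Instead of
membership in a Sobolev space, the existence of smooth approximations is recorded. -/
structure IsWeakPoissonSolution (U : TopologicalSpace.Opens (Euc N)) (u g : Euc N → ℝ)
    (G : Euc N → Euc N) : Prop where
  exists_approx : ∃ φ, IsSmoothApprox U u G φ
  locallyIntegrableOn : LocallyIntegrableOn g (U : Set (Euc N))
  integral_eq : ∀ ψ : 𝓓(U, ℝ), ∫ x in (U : Set (Euc N)), ⟪G x, ∇ ψ x⟫_ℝ =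
    ∫ x in (U : Set (Euc N)), ψ x * g x

theorem MeasureTheory.LocallyIntegrableOn.integrable_mul_of_tsupport_subset
    {U : TopologicalSpace.Opens (Euc N)} {g ζ : Euc N → ℝ}
    (hg : LocallyIntegrableOn g (U : Set (Euc N))) (hζ : Continuous ζ)
    (hζc : HasCompactSupport ζ) (hζU : tsupport ζ ⊆ U) :
    Integrable (fun x => ζ x * g x) := by
  have h1 : IntegrableOn g (tsupport ζ) := hg.integrableOn_compact_subset hζU hζc
  have h2 : IntegrableOn (fun x => ζ x * g x) (tsupport ζ) :=
    h1.continuousOn_mul hζ.continuousOn hζc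
  rwa [integrableOn_iff_integrable_of_support_subset] at h2
  exact (Function.support_mul_subset_left ζ g).trans (subset_tsupport ζ)

theorem IsSmoothApprox.aestronglyMeasurable {U : TopologicalSpace.Opens (Euc N)}
    {u : Euc N → ℝ} {G : Euc N → Euc N} {φ : ℕ → Euc N → ℝ} (h : IsSmoothApprox U u G φ) :
    AEStronglyMeasurable u (volume.restrict (U : Set (Euc N))) :=
  aestronglyMeasurable_of_tendsto_ae atTop
    (fun n => (h.contDiff n).continuous.aestronglyMeasurable) h.ae_tendsto

theorem memLp_of_continuous_of_hasCompactSupport {F : Type*} [NormedAddCommGroup F]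
    [InnerProductSpace ℝ F] [FiniteDimensional ℝ F]
    {V : Euc N → F} (hV : Continuous V) (hVc : HasCompactSupport V) (s : Set (Euc N)) :
    MemLp V 2 (volume.restrict s) :=
  (hV.memLp_of_hasCompactSupport hVc).restrict s

theorem hasCompactSupport_gradient {ζ : Euc N → ℝ} (hζc : HasCompactSupport ζ) :
    HasCompactSupport (∇ ζ) :=
  hζc.mono' (fun x hx => by
    by_contra h
    exact hx (gradient_eq_zero_of_notMem_tsupport ζ h))

/-- The equation tested with `ζ T(w - u)`, with the gradient of the test function written out. It is
obtained from the test functions `ζ T(w - φₙ)`, where `φₙ` are smooth approximations of `u`. -/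
theorem IsWeakPoissonSolution.integral_comp {U : TopologicalSpace.Opens (Euc N)}
    {u g : Euc N → ℝ} {G : Euc N → Euc N} (h : IsWeakPoissonSolution U u g G)
    {ζ w : Euc N → ℝ} {T : ℝ → ℝ} {M : ℝ} (hζ : ContDiff ℝ ∞ ζ) (hζc : HasCompactSupport ζ)
    (hζU : tsupport ζ ⊆ U) (hw : ContDiff ℝ ∞ w) (hT : ContDiff ℝ ∞ T)
    (hTM : ∀ t, |T t| ≤ M) (hTM' : ∀ t, |deriv T t| ≤ M) :
    (∫ x in (U : Set (Euc N)), T (w x - u x) * ⟪G x, ∇ ζ x⟫_ℝ) +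
        (∫ x in (U : Set (Euc N)), deriv T (w x - u x) * (ζ x * ⟪G x, ∇ w x⟫_ℝ)) -
        (∫ x in (U : Set (Euc N)), (deriv T (w x - u x) * ζ x) * ⟪G x, G x⟫_ℝ) =
      ∫ x in (U : Set (Euc N)), T (w x - u x) * (ζ x * g x) := by
  obtain ⟨φ, hφ⟩ := h.exists_approx
  have hM : 0 ≤ M := (abs_nonneg _).trans (hTM 0)
  have hT'c : Continuous (deriv T) := hT.continuous_deriv (by simp)
  obtain ⟨B, hB⟩ := hζ.continuous.bounded_above_of_compact_support hζc
  have hB0 : 0 ≤ B := (norm_nonneg _).trans (hB 0)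
  have hzc (n : ℕ) : Continuous fun x => w x - φ n x :=
    hw.continuous.sub (hφ.contDiff n).continuous
  have hlimT {S : ℝ → ℝ} (hS : Continuous S) : ∀ᵐ x ∂volume.restrict (U : Set (Euc N)),
      Tendsto (fun n => S (w x - φ n x)) atTop (𝓝 (S (w x - u x))) := by
    filter_upwards [hφ.ae_tendsto] with x hx
    exact (hS.tendsto _).comp (tendsto_const_nhds.sub hx)
  have hmeas {S : ℝ → ℝ} (hS : Continuous S) (n : ℕ) :
      AEStronglyMeasurable (fun x => S (w x - φ n x)) (volume.restrict (U : Set (Euc N))) :=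
    (hS.comp (hzc n)).aestronglyMeasurable
  have hζ2 : MemLp (∇ ζ) 2 (volume.restrict (U : Set (Euc N))) :=
    memLp_of_continuous_of_hasCompactSupport (continuous_gradient hζ)
      (hasCompactSupport_gradient hζc) _
  have hw2 : MemLp (fun x => ζ x • ∇ w x) 2 (volume.restrict (U : Set (Euc N))) :=
    memLp_of_continuous_of_hasCompactSupport (hζ.continuous.smul (continuous_gradient hw))
      hζc.smul_right _
  have hi1 := integrable_inner_of_memLp_two hφ.memLp hζ2
  have hi2 : Integrable (fun x => ζ x * ⟪G x, ∇ w x⟫_ℝ) (volume.restrict (U : Set (Euc N))) := by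
    simpa only [inner_smul_right] using integrable_inner_of_memLp_two hφ.memLp hw2
  have hg : Integrable (fun x => ζ x * g x) (volume.restrict (U : Set (Euc N))) :=
    (h.locallyIntegrableOn.integrable_mul_of_tsupport_subset hζ.continuous hζc hζU).restrict
  have l1 := tendsto_integral_bdd_mul (hmeas hT.continuous) (fun n x => hTM _)
    (hlimT hT.continuous) hi1
  have l2 := tendsto_integral_bdd_mul (hmeas hT'c) (fun n x => hTM' _) (hlimT hT'c) hi2
  have l3 := tendsto_integral_bdd_mul_inner (a := fun n x => deriv T (w x - φ n x) * ζ x)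
    (b := fun x => deriv T (w x - u x) * ζ x) (M := M * B) (by positivity)
    (fun n => (hmeas hT'c n).mul hζ.continuous.aestronglyMeasurable)
    (fun n x => by
      rw [abs_mul]
      exact mul_le_mul (hTM' _) (hB x) (abs_nonneg _) hM)
    (by filter_upwards [hlimT hT'c] with x hx using hx.mul_const _)
    hφ.memLp hφ.memLp
    (fun n => (continuous_gradient (hφ.contDiff n)).aestronglyMeasurable) hφ.tendsto_gradient
  have l4 := tendsto_integral_bdd_mul (hmeas hT.continuous) (fun n x => hTM _)
    (hlimT hT.continuous) hg
  refine tendsto_nhds_unique ((l1.add l2).sub l3) (l4.congr' ?_)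
  have hev : ∀ᶠ n in atTop, MemLp (∇ (φ n)) 2 (volume.restrict (U : Set (Euc N))) := by
    filter_upwards [hφ.tendsto_gradient.eventually
      (gt_mem_nhds (show (0 : ENNReal) < 1 by simp))] with n hn
    have h1 : MemLp (fun x => G x - ∇ (φ n) x) 2 (volume.restrict (U : Set (Euc N))) :=
      ⟨hφ.memLp.aestronglyMeasurable.sub
        (continuous_gradient (hφ.contDiff n)).aestronglyMeasurable, hn.trans (by simp)⟩
    refine (hφ.memLp.sub h1).ae_eq (Eventually.of_forall fun x => ?_)
    simp
  filter_upwards [hev] with n hn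
  let ψ : 𝓓(U, ℝ) := ⟨fun x => ζ x * T (w x - φ n x),
    hζ.mul (hT.comp (hw.sub (hφ.contDiff n))), hζc.mul_right,
    (tsupport_mul_subset_left).trans hζU⟩
  have key := h.integral_eq ψ
  have hψ (x : Euc N) : ⟪G x, ∇ ψ x⟫_ℝ = T (w x - φ n x) * ⟪G x, ∇ ζ x⟫_ℝ +
      deriv T (w x - φ n x) * (ζ x * ⟪G x, ∇ w x⟫_ℝ) -
      (deriv T (w x - φ n x) * ζ x) * ⟪G x, ∇ (φ n) x⟫_ℝ := by
    have : ∇ ψ x = _ := gradient_mul_comp_sub (hζ.differentiable (by simp) x)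
      (hw.differentiable (by simp) x) ((hφ.contDiff n).differentiable (by simp) x)
      (hT.differentiable (by simp))
    rw [this]
    simp only [inner_add_right, inner_smul_right, inner_sub_right]
    ring
  simp only [hψ] at key
  rw [integral_sub, integral_add] at key
  · rw [key]
    refine integral_congr_ae (Eventually.of_forall fun x => ?_)
    change T (w x - φ n x) * (ζ x * g x) = ζ x * T (w x - φ n x) * g x
    ring
  · exact hi1.bdd_mul (hmeas hT.continuous n) (Eventually.of_forall fun x => hTM _)
  · exact hi2.bdd_mul (hmeas hT'c n) (Eventually.of_forall fun x => hTM' _)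
  · exact (hi1.bdd_mul (hmeas hT.continuous n) (Eventually.of_forall fun x => hTM _)).add
      (hi2.bdd_mul (hmeas hT'c n) (Eventually.of_forall fun x => hTM' _))
  · refine (integrable_inner_of_memLp_two hφ.memLp hn).bdd_mul (c := M * B)
      ((hmeas hT'c n).mul hζ.continuous.aestronglyMeasurable) (Eventually.of_forall fun x => ?_)
    rw [norm_mul]
    exact mul_le_mul (hTM' _) (hB x) (norm_nonneg _) hM

/-- The divergence theorem for the vector field `f k (x - x₀)`. -/
theorem integral_mul_inner_gradient_sub {f k : Euc N → ℝ} (hf : ContDiff ℝ ∞ f)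
    (hk : ContDiff ℝ ∞ k) (hkc : HasCompactSupport k) (x₀ : Euc N) :
    ∫ x, k x * ⟪∇ f x, x - x₀⟫_ℝ = -∫ x, f x * (N * k x + ⟪∇ k x, x - x₀⟫_ℝ) := by
  have hf' := hf.continuous_fderiv (by simp)
  have hk' := hk.continuous_fderiv (by simp)
  have hkd := hk.differentiable (by simp)
  let e : Fin N → Euc N := fun i => EuclideanSpace.basisFun (Fin N) ℝ i
  have hsum (L : Euc N →L[ℝ] ℝ) (v : Euc N) : ∑ i, L (e i) * v i = L v := by
    conv_rhs => rw [← (EuclideanSpace.basisFun (Fin N) ℝ).sum_repr v]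
    simp [e, mul_comm]
  have hg (i : Fin N) (x : Euc N) : HasFDerivAt (fun x : Euc N => k x * (x i - x₀ i))
      (k x • (EuclideanSpace.proj i : Euc N →L[ℝ] ℝ) + (x i - x₀ i) • fderiv ℝ k x) x :=
    (hkd x).hasFDerivAt.mul
      ((EuclideanSpace.proj i : Euc N →L[ℝ] ℝ).hasFDerivAt.sub_const (x₀ i))
  have hg' (i : Fin N) (x : Euc N) : fderiv ℝ (fun x : Euc N => k x * (x i - x₀ i)) x (e i) =
      k x + (x i - x₀ i) * fderiv ℝ k x (e i) := by
    rw [(hg i x).fderiv]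
    simp [e]
  have hsub (i : Fin N) : Continuous fun x : Euc N => x i - x₀ i := by fun_prop
  have hk'c : HasCompactSupport (fderiv ℝ k) := hkc.fderiv ℝ
  have hk'e (i : Fin N) : HasCompactSupport fun x => fderiv ℝ k x (e i) :=
    hk'c.comp_left (g := fun L : Euc N →L[ℝ] ℝ => L (e i)) (by simp)
  have I1 (i : Fin N) : Integrable fun x => fderiv ℝ f x (e i) * (k x * (x i - x₀ i)) :=
    Continuous.integrable_of_hasCompactSupport
      ((hf'.clm_apply continuous_const).mul (hk.continuous.mul (hsub i)))
      hkc.mul_right.mul_left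
  have I2 (i : Fin N) : Integrable fun x => f x * (k x + (x i - x₀ i) * fderiv ℝ k x (e i)) :=
    Continuous.integrable_of_hasCompactSupport
      (hf.continuous.mul (hk.continuous.add ((hsub i).mul (hk'.clm_apply continuous_const))))
      ((hkc.add (hk'e i).mul_left).mul_left)
  have parts (i : Fin N) : ∫ x, f x * (k x + (x i - x₀ i) * fderiv ℝ k x (e i)) =
      -∫ x, fderiv ℝ f x (e i) * (k x * (x i - x₀ i)) := by
    rw [← integral_mul_fderiv_eq_neg_fderiv_mul_of_integrable (v := e i) (I1 i)]
    · simp only [hg']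
    · simpa only [hg'] using I2 i
    · exact (hf.continuous.mul (hk.continuous.mul (hsub i))).integrable_of_hasCompactSupport
        hkc.mul_right.mul_left
    · exact fun x _ => (hf.differentiable (by simp)) x
    · exact fun x _ => (hg i x).differentiableAt
  have e1 : ∫ x, k x * ⟪∇ f x, x - x₀⟫_ℝ =
      ∑ i, ∫ x, fderiv ℝ f x (e i) * (k x * (x i - x₀ i)) := by
    rw [← integral_finsetSum _ fun i _ => I1 i]
    refine integral_congr_ae (Eventually.of_forall fun x => ?_)
    simp only [inner_gradient_left]
    rw [← hsum _ (x - x₀), Finset.mul_sum]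
    refine Finset.sum_congr rfl fun i _ => ?_
    simp only [PiLp.sub_apply]
    ring
  have e2 : ∫ x, f x * (N * k x + ⟪∇ k x, x - x₀⟫_ℝ) =
      ∑ i, ∫ x, f x * (k x + (x i - x₀ i) * fderiv ℝ k x (e i)) := by
    rw [← integral_finsetSum _ fun i _ => I2 i]
    refine integral_congr_ae (Eventually.of_forall fun x => ?_)
    simp only [inner_gradient_left]
    rw [← hsum _ (x - x₀), ← Finset.mul_sum, Finset.sum_add_distrib]
    simp [mul_comm]
  rw [e1, e2, Finset.sum_congr rfl fun i _ => parts i, Finset.sum_neg_distrib, neg_neg]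

/-- The divergence theorem for the vector field `S(w - u) k (x - x₀)`: the function `S(w - u)` has
weak gradient `S'(w - u) (∇w - G)`. -/
theorem IsSmoothApprox.integral_deriv_comp_mul {U : TopologicalSpace.Opens (Euc N)}
    {u : Euc N → ℝ} {G : Euc N → Euc N} {φ : ℕ → Euc N → ℝ} (hφ : IsSmoothApprox U u G φ)
    {k w : Euc N → ℝ} {S : ℝ → ℝ} {M : ℝ} (hk : ContDiff ℝ ∞ k) (hkc : HasCompactSupport k)
    (hkU : tsupport k ⊆ U) (hw : ContDiff ℝ ∞ w) (hS : ContDiff ℝ ∞ S)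
    (hSM : ∀ t, |S t| ≤ M) (hSM' : ∀ t, |deriv S t| ≤ M) (x₀ : Euc N) :
    (∫ x in (U : Set (Euc N)), deriv S (w x - u x) * (k x * ⟪∇ w x, x - x₀⟫_ℝ)) -
        (∫ x in (U : Set (Euc N)), deriv S (w x - u x) * ⟪k x • (x - x₀), G x⟫_ℝ) =
      -∫ x in (U : Set (Euc N)), S (w x - u x) * (N * k x + ⟪∇ k x, x - x₀⟫_ℝ) := by
  have hM : 0 ≤ M := (abs_nonneg _).trans (hSM 0)
  have hS'c : Continuous (deriv S) := hS.continuous_deriv (by simp)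
  have hzc (n : ℕ) : Continuous fun x => w x - φ n x :=
    hw.continuous.sub (hφ.contDiff n).continuous
  have hlimT {S : ℝ → ℝ} (hS : Continuous S) : ∀ᵐ x ∂volume.restrict (U : Set (Euc N)),
      Tendsto (fun n => S (w x - φ n x)) atTop (𝓝 (S (w x - u x))) := by
    filter_upwards [hφ.ae_tendsto] with x hx
    exact (hS.tendsto _).comp (tendsto_const_nhds.sub hx)
  have hmeas {S : ℝ → ℝ} (hS : Continuous S) (n : ℕ) :
      AEStronglyMeasurable (fun x => S (w x - φ n x)) (volume.restrict (U : Set (Euc N))) :=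
    (hS.comp (hzc n)).aestronglyMeasurable
  have hk2 : MemLp (fun x => k x • (x - x₀)) 2 (volume.restrict (U : Set (Euc N))) :=
    memLp_of_continuous_of_hasCompactSupport (hk.continuous.smul (by fun_prop))
      hkc.smul_right _
  have hi1 : Integrable (fun x => k x * ⟪∇ w x, x - x₀⟫_ℝ)
      (volume.restrict (U : Set (Euc N))) :=
    (Continuous.integrable_of_hasCompactSupport (hk.continuous.mul
      ((continuous_gradient hw).inner (by fun_prop))) hkc.mul_right).restrict
  have hi2 : Integrable (fun x => N * k x + ⟪∇ k x, x - x₀⟫_ℝ)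
      (volume.restrict (U : Set (Euc N))) := by
    refine (Continuous.integrable_of_hasCompactSupport ((continuous_const.mul hk.continuous).add
      ((continuous_gradient hk).inner (by fun_prop))) ?_).restrict
    refine hkc.mono' fun x hx => ?_
    by_contra hx'
    refine hx ?_
    change N * k x + ⟪∇ k x, x - x₀⟫_ℝ = 0
    rw [gradient_eq_zero_of_notMem_tsupport k hx', image_eq_zero_of_notMem_tsupport hx',
      inner_zero_left,
      mul_zero, zero_add]
  have l1 := tendsto_integral_bdd_mul (hmeas hS'c) (fun n x => hSM' _) (hlimT hS'c) hi1
  have l2 := tendsto_integral_bdd_mul_inner hM (hmeas hS'c) (fun n x => hSM' _) (hlimT hS'c)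
    hk2 hφ.memLp
    (fun n => (continuous_gradient (hφ.contDiff n)).aestronglyMeasurable) hφ.tendsto_gradient
  have l3 := tendsto_integral_bdd_mul (hmeas hS.continuous) (fun n x => hSM _)
    (hlimT hS.continuous) hi2
  refine tendsto_nhds_unique (l1.sub l2) (l3.neg.congr fun n => ?_)
  have hfs : ContDiff ℝ ∞ fun x => S (w x - φ n x) := hS.comp (hw.sub (hφ.contDiff n))
  have key := integral_mul_inner_gradient_sub hfs hk hkc x₀
  have hgrad (x : Euc N) : ∇ (fun x => S (w x - φ n x)) x =
      deriv S (w x - φ n x) • (∇ w x - ∇ (φ n) x) := by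
    have := gradient_mul_comp_sub (ζ := fun _ => 1) (x := x) (differentiableAt_const _)
      (hw.differentiable (by simp) x) ((hφ.contDiff n).differentiable (by simp) x)
      (hS.differentiable (by simp))
    simpa using this
  have s1 : ∫ x in (U : Set (Euc N)), k x * ⟪∇ (fun x => S (w x - φ n x)) x, x - x₀⟫_ℝ =
      ∫ x, k x * ⟪∇ (fun x => S (w x - φ n x)) x, x - x₀⟫_ℝ := by
    refine setIntegral_eq_integral_of_forall_compl_eq_zero fun x hx => ?_
    rw [image_eq_zero_of_notMem_tsupport fun h => hx (hkU h), zero_mul]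
  have s2 : ∫ x in (U : Set (Euc N)), S (w x - φ n x) * (N * k x + ⟪∇ k x, x - x₀⟫_ℝ) =
      ∫ x, S (w x - φ n x) * (N * k x + ⟪∇ k x, x - x₀⟫_ℝ) := by
    refine setIntegral_eq_integral_of_forall_compl_eq_zero fun x hx => ?_
    have hx' : x ∉ tsupport k := fun h => hx (hkU h)
    rw [gradient_eq_zero_of_notMem_tsupport k hx', image_eq_zero_of_notMem_tsupport hx',
      inner_zero_left,
      mul_zero, zero_add, mul_zero]
  rw [s2, ← key, ← s1, ← integral_sub]
  · refine integral_congr_ae (Eventually.of_forall fun x => ?_)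
    simp only [hgrad, inner_smul_left, inner_sub_left, real_inner_comm (∇ (φ n) x)]
    simp
    ring
  · exact hi1.bdd_mul (hmeas hS'c n) (Eventually.of_forall fun x => hSM' _)
  · refine Integrable.bdd_mul (c := M) ?_ (hmeas hS'c n) (Eventually.of_forall fun x => hSM' _)
    refine (Continuous.integrable_of_hasCompactSupport ?_ ?_).restrict
    · exact (hk.continuous.smul (by fun_prop)).inner (continuous_gradient (hφ.contDiff n))
    · refine hkc.mono fun x hx hx' => hx ?_
      simp [hx']

/-! ### Truncations of the solution are superharmonic -/

noncomputable section

/-- A smooth function with compact support in `[a, b]`, equal to `1` on `[a + d, b - 1]`. -/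
def plateau (a d b t : ℝ) : ℝ := Real.smoothTransition ((t - a) / d) * Real.smoothTransition (b - t)

/-- The primitive of `b` that vanishes at `0`. -/
def primitive (b : ℝ → ℝ) (t : ℝ) : ℝ := ∫ s in (0 : ℝ)..t, b s

end

theorem contDiff_plateau (a d b : ℝ) : ContDiff ℝ ∞ (plateau a d b) :=
  (Real.smoothTransition.contDiff.comp ((contDiff_id.sub contDiff_const).div_const d)).mul
    (Real.smoothTransition.contDiff.comp (contDiff_const.sub contDiff_id))

theorem plateau_nonneg (a d b t : ℝ) : 0 ≤ plateau a d b t :=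
  mul_nonneg (Real.smoothTransition.nonneg _) (Real.smoothTransition.nonneg _)

theorem plateau_le_one (a d b t : ℝ) : plateau a d b t ≤ 1 :=
  mul_le_one₀ (Real.smoothTransition.le_one _) (Real.smoothTransition.nonneg _)
    (Real.smoothTransition.le_one _)

theorem plateau_pos {a d b t : ℝ} (hd : 0 < d) (ha : a < t) (hb : t < b) : 0 < plateau a d b t :=
  mul_pos (Real.smoothTransition.pos_of_pos (div_pos (sub_pos.2 ha) hd))
    (Real.smoothTransition.pos_of_pos (sub_pos.2 hb))

theorem plateau_eq_zero_of_le {a d b t : ℝ} (hd : 0 < d) (ha : t ≤ a) : plateau a d b t = 0 := by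
  rw [plateau, Real.smoothTransition.zero_of_nonpos
    (div_nonpos_of_nonpos_of_nonneg (sub_nonpos.2 ha) hd.le), zero_mul]

theorem plateau_eq_zero_of_ge {a d b t : ℝ} (hb : b ≤ t) : plateau a d b t = 0 := by
  rw [plateau, Real.smoothTransition.zero_of_nonpos (sub_nonpos.2 hb), mul_zero]

theorem plateau_eq_one {a d b t : ℝ} (hd : 0 < d) (ha : a + d ≤ t) (hb : t ≤ b - 1) :
    plateau a d b t = 1 := by
  rw [plateau, Real.smoothTransition.one_of_one_le, Real.smoothTransition.one_of_one_le, one_mul]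
  · linarith
  · rw [one_le_div hd]; linarith

theorem hasCompactSupport_plateau {a d b : ℝ} (hd : 0 < d) : HasCompactSupport (plateau a d b) :=
  HasCompactSupport.intro (isCompact_Icc (a := a) (b := b)) fun t ht => by
    rw [Set.mem_Icc, not_and_or, not_le, not_le] at ht
    rcases ht with ht | ht
    · exact plateau_eq_zero_of_le hd ht.le
    · exact plateau_eq_zero_of_ge ht.le

theorem deriv_plateau_nonneg {a d b t : ℝ} (hd : 0 < d) (ht : t < b - 1) :
    0 ≤ deriv (plateau a d b) t := by
  have h : plateau a d b =ᶠ[𝓝 t] fun t => Real.smoothTransition ((t - a) / d) := by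
    filter_upwards [gt_mem_nhds ht] with s hs
    rw [plateau, Real.smoothTransition.one_of_one_le (x := b - s) (by linarith), mul_one]
  rw [h.deriv_eq]
  refine Monotone.deriv_nonneg fun s t hst => Real.smoothTransition.monotone ?_
  gcongr

theorem hasDerivAt_primitive {b : ℝ → ℝ} (hb : Continuous b) (t : ℝ) :
    HasDerivAt (primitive b) (b t) t :=
  hb.integral_hasStrictDerivAt 0 t |>.hasDerivAt

theorem deriv_primitive {b : ℝ → ℝ} (hb : Continuous b) : deriv (primitive b) = b :=
  funext fun t => (hasDerivAt_primitive hb t).deriv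

theorem contDiff_primitive {b : ℝ → ℝ} (hb : ContDiff ℝ ∞ b) : ContDiff ℝ ∞ (primitive b) := by
  rw [contDiff_infty_iff_deriv, deriv_primitive hb.continuous]
  exact ⟨fun t => (hasDerivAt_primitive hb.continuous t).differentiableAt, hb⟩

theorem exists_abs_primitive_le {b : ℝ → ℝ} (hb : Continuous b) (hbc : HasCompactSupport b) :
    ∃ M, ∀ t, |primitive b t| ≤ M := by
  refine ⟨∫ s, ‖b s‖, fun t => ?_⟩
  refine (intervalIntegral.norm_integral_le_integral_norm_uIoc (f := b)).trans ?_
  exact setIntegral_le_integral (hb.integrable_of_hasCompactSupport hbc).norm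
    (Eventually.of_forall fun _ => norm_nonneg _)

theorem primitive_zero (b : ℝ → ℝ) : primitive b 0 = 0 := intervalIntegral.integral_same

theorem primitive_sub {b : ℝ → ℝ} (hb : Continuous b) (s t : ℝ) :
    primitive b t - primitive b s = ∫ r in s..t, b r :=
  intervalIntegral.integral_interval_sub_left (hb.intervalIntegrable _ _)
    (hb.intervalIntegrable _ _)

theorem monotone_primitive {b : ℝ → ℝ} (hb : Continuous b) (h0 : ∀ t, 0 ≤ b t) :
    Monotone (primitive b) := fun s t hst => by
  have := intervalIntegral.integral_nonneg (μ := volume) hst (fun r _ => h0 r)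
  rw [← primitive_sub hb] at this
  linarith

theorem exists_abs_le_of_hasCompactSupport {b : ℝ → ℝ} (hb : Continuous b)
    (hbc : HasCompactSupport b) : ∃ M, ∀ t, |b t| ≤ M :=
  hb.bounded_above_of_compact_support hbc

noncomputable section

/-- A smooth bounded truncation `τ` of the positive half-line: `0 < τ(s) ≤ s` for `s > 0`, and `τ` is
increasing and concave there, with `τ' = 0` on `[1, ∞)`. It is the reflection of a primitive, since
`IsWeakPoissonSolution.integral_comp` is used with `w = 0`, that is, for functions of `-u`. -/
def truncation (s : ℝ) : ℝ := -primitive (plateau (-1) 1 1) (-s)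

end

theorem truncation_pos {s : ℝ} (hs : 0 < s) : 0 < truncation s := by
  have hc := (contDiff_plateau (-1) 1 1).continuous
  have h := primitive_sub hc (-s) 0
  rw [primitive_zero, zero_sub] at h
  rw [truncation, h]
  have h1 : 0 < ∫ r in (-min s 1)..0, plateau (-1) 1 1 r := by
    refine intervalIntegral.intervalIntegral_pos_of_pos_on (hc.intervalIntegrable _ _) ?_ ?_
    · intro x hx
      have : -1 ≤ -min s 1 := neg_le_neg (min_le_right _ _)
      exact plateau_pos one_pos (by linarith [hx.1]) (by linarith [hx.2])
    · simpa using hs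
  refine h1.trans_le ?_
  rw [← primitive_sub hc, ← primitive_sub hc]
  have := monotone_primitive hc (plateau_nonneg (-1) 1 1)
    (neg_le_neg (min_le_left s 1) : -s ≤ -min s 1)
  linarith

theorem truncation_le {s : ℝ} (hs : 0 ≤ s) : truncation s ≤ s := by
  have hc := (contDiff_plateau (-1) 1 1).continuous
  have h := primitive_sub hc (-s) 0
  rw [primitive_zero, zero_sub] at h
  rw [truncation, h]
  have h1 := intervalIntegral.integral_mono_on (μ := volume) (neg_nonpos.2 hs)
    (hc.intervalIntegrable _ _)
    (continuous_const.intervalIntegrable (μ := volume) _ _)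
    (fun x _ => plateau_le_one (-1) 1 1 x)
  simpa using h1

theorem continuous_truncation : Continuous truncation :=
  ((contDiff_primitive (contDiff_plateau (-1) 1 1)).continuous.comp continuous_neg).neg

theorem exists_abs_truncation_le : ∃ M, ∀ s, |truncation s| ≤ M := by
  obtain ⟨M, hM⟩ := exists_abs_primitive_le (contDiff_plateau (-1) 1 1).continuous
    (hasCompactSupport_plateau one_pos)
  exact ⟨M, fun s => by rw [truncation, abs_neg]; exact hM _⟩

/-- If `u > 0` and `g ≥ 0` where `u < 1`, then the truncation of `u` is weakly superharmonic:
its integral against the Laplacian of `ζ ≥ 0` is nonpositive. Only test functions with gradient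
`k (x - x₀)` occur, so the Laplacian is `N k + ⟪∇k, x - x₀⟫`. -/
theorem IsWeakPoissonSolution.integral_truncation_le {U : TopologicalSpace.Opens (Euc N)}
    {u g : Euc N → ℝ} {G : Euc N → Euc N} (h : IsWeakPoissonSolution U u g G)
    (hu : ∀ᵐ x ∂volume.restrict (U : Set (Euc N)), 0 < u x)
    (hg : ∀ᵐ x ∂volume.restrict (U : Set (Euc N)), u x < 1 → 0 ≤ g x)
    {ζ k : Euc N → ℝ} (hζ : ContDiff ℝ ∞ ζ) (hζc : HasCompactSupport ζ)
    (hζU : tsupport ζ ⊆ U) (hζ0 : ∀ x, 0 ≤ ζ x) (hk : ContDiff ℝ ∞ k)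
    (hkc : HasCompactSupport k) (hkU : tsupport k ⊆ U) (x₀ : Euc N)
    (hζk : ∀ x, ∇ ζ x = k x • (x - x₀)) :
    ∫ x in (U : Set (Euc N)), truncation (u x) * (N * k x + ⟪∇ k x, x - x₀⟫_ℝ) ≤ 0 := by
  have hT := contDiff_plateau (-1) 1 1
  have hTc : HasCompactSupport (plateau (-1) 1 1) := hasCompactSupport_plateau one_pos
  obtain ⟨M₁, hM₁⟩ := exists_abs_le_of_hasCompactSupport (hT.continuous_deriv (by simp)) hTc.deriv
  obtain ⟨M₂, hM₂⟩ := exists_abs_le_of_hasCompactSupport hT.continuous hTc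
  obtain ⟨M₃, hM₃⟩ := exists_abs_primitive_le hT.continuous hTc
  have e1 := h.integral_comp (w := fun _ => 0) (M := max M₁ M₂) hζ hζc hζU contDiff_const hT
    (fun t => (hM₂ t).trans (le_max_right _ _)) (fun t => (hM₁ t).trans (le_max_left _ _))
  obtain ⟨φ, hφ⟩ := h.exists_approx
  have e2 := hφ.integral_deriv_comp_mul (w := fun _ => 0) (M := max M₂ M₃) hk hkc hkU
    contDiff_const (contDiff_primitive hT) (fun t => (hM₃ t).trans (le_max_right _ _))
    (fun t => by rw [deriv_primitive hT.continuous]; exact (hM₂ t).trans (le_max_left _ _)) x₀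
  have hgr : ∀ x, ∇ (fun _ : Euc N => (0 : ℝ)) x = 0 := fun x => by simp [gradient]
  simp only [hgr, inner_zero_right, inner_zero_left, mul_zero, integral_zero, zero_sub,
    add_zero, deriv_primitive hT.continuous] at e1 e2
  have i1 : 0 ≤ ∫ x in (U : Set (Euc N)),
      (deriv (plateau (-1) 1 1) (-u x) * ζ x) * ⟪G x, G x⟫_ℝ := by
    refine integral_nonneg_of_ae ?_
    filter_upwards [hu] with x hx
    exact mul_nonneg (mul_nonneg (deriv_plateau_nonneg one_pos (by linarith)) (hζ0 x))
      real_inner_self_nonneg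
  have i2 : 0 ≤ ∫ x in (U : Set (Euc N)), plateau (-1) 1 1 (-u x) * (ζ x * g x) := by
    refine integral_nonneg_of_ae ?_
    filter_upwards [hg] with x hx
    by_cases hx1 : u x < 1
    · exact mul_nonneg (plateau_nonneg _ _ _ _) (mul_nonneg (hζ0 x) (hx hx1))
    · rw [plateau_eq_zero_of_le one_pos (by linarith), zero_mul]; rfl
  have i3 : ∫ x in (U : Set (Euc N)), plateau (-1) 1 1 (-u x) * ⟪G x, ∇ ζ x⟫_ℝ =
      ∫ x in (U : Set (Euc N)), plateau (-1) 1 1 (-u x) * ⟪k x • (x - x₀), G x⟫_ℝ := by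
    simp only [hζk, real_inner_comm]
  simp only [truncation, neg_mul, integral_neg]
  linarith

noncomputable section

/-- A smooth function of `t = |x|² / r²`, positive for `t < 1` and zero for `1 ≤ t`. -/
def ballCutoff (t : ℝ) : ℝ := Real.smoothTransition (2 - 2 * t)

end

theorem contDiff_ballCutoff : ContDiff ℝ ∞ ballCutoff :=
  Real.smoothTransition.contDiff.comp (contDiff_const.sub (contDiff_const.mul contDiff_id))

theorem ballCutoff_nonneg (t : ℝ) : 0 ≤ ballCutoff t := Real.smoothTransition.nonneg _

theorem ballCutoff_le_one (t : ℝ) : ballCutoff t ≤ 1 := Real.smoothTransition.le_one _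

theorem ballCutoff_eq_zero {t : ℝ} (ht : 1 ≤ t) : ballCutoff t = 0 :=
  Real.smoothTransition.zero_of_nonpos (by linarith)

theorem ballCutoff_pos {t : ℝ} (ht : t < 1) : 0 < ballCutoff t :=
  Real.smoothTransition.pos_of_pos (by linarith)

theorem deriv_ballCutoff_eq_zero {t : ℝ} (ht : 1 < t) : deriv ballCutoff t = 0 := by
  have : ballCutoff =ᶠ[𝓝 t] fun _ => 0 := by
    filter_upwards [lt_mem_nhds ht] with s hs using ballCutoff_eq_zero hs.le
  rw [this.deriv_eq, deriv_const]

theorem gradient_comp_norm_sq {H : ℝ → ℝ} {x₀ x : Euc N} {c : ℝ}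
    (hH : DifferentiableAt ℝ H (‖x - x₀‖ ^ 2 * c)) :
    ∇ (fun x => H (‖x - x₀‖ ^ 2 * c)) x =
      (2 * c * deriv H (‖x - x₀‖ ^ 2 * c)) • (x - x₀) := by
  have h1 : HasFDerivAt (fun x : Euc N => ‖x - x₀‖ ^ 2) _ x :=
    ((hasFDerivAt_id x).sub_const x₀).norm_sq
  have h2 : HasFDerivAt (fun x : Euc N => H (‖x - x₀‖ ^ 2 * c)) _ x :=
    hH.hasDerivAt.comp_hasFDerivAt x (h1.mul_const c)
  refine ext_inner_right ℝ fun v => ?_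
  rw [inner_gradient_left, h2.fderiv]
  simp [inner_smul_left, inner_sub_left]
  ring

theorem contDiff_comp_norm_sq {H : ℝ → ℝ} (hH : ContDiff ℝ ∞ H) (x₀ : Euc N) (c : ℝ) :
    ContDiff ℝ ∞ fun x => H (‖x - x₀‖ ^ 2 * c) :=
  hH.comp (((contDiff_id.sub contDiff_const).norm_sq ℝ).mul contDiff_const)

theorem tsupport_comp_norm_sq_subset {H : ℝ → ℝ} (hH : ∀ t, 1 ≤ t → H t = 0) (x₀ : Euc N)
    {r : ℝ} (hr : 0 < r) :
    tsupport (fun x => H (‖x - x₀‖ ^ 2 * (r ^ 2)⁻¹)) ⊆ Metric.closedBall x₀ r := by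
  refine closure_minimal (fun x hx => ?_) Metric.isClosed_closedBall
  by_contra hx'
  refine hx (hH _ ?_)
  rw [Metric.mem_closedBall, not_le, dist_eq_norm] at hx'
  rw [← div_eq_mul_inv, one_le_div (by positivity)]
  gcongr

/-- Superharmonicity of the truncation tested with the primitive of `ballCutoff (|x - x₀|² / r²)`. The
weight is the negative `r`-derivative of `r ^ (-N) * ballCutoff (|x - x₀|² / r²)`, up to a power
of `r`. -/
theorem IsWeakPoissonSolution.integral_truncation_mul_nonneg {U : TopologicalSpace.Opens (Euc N)}
    {u g : Euc N → ℝ} {G : Euc N → Euc N} (h : IsWeakPoissonSolution U u g G)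
    (hu : ∀ᵐ x ∂volume.restrict (U : Set (Euc N)), 0 < u x)
    (hg : ∀ᵐ x ∂volume.restrict (U : Set (Euc N)), u x < 1 → 0 ≤ g x)
    {x₀ : Euc N} {r : ℝ} (hr : 0 < r) (hU : Metric.closedBall x₀ r ⊆ U) :
    0 ≤ ∫ x in (U : Set (Euc N)), truncation (u x) *
      (N * ballCutoff (‖x - x₀‖ ^ 2 * (r ^ 2)⁻¹) + 2 * (‖x - x₀‖ ^ 2 * (r ^ 2)⁻¹) *
        deriv ballCutoff (‖x - x₀‖ ^ 2 * (r ^ 2)⁻¹)) := by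
  set c : ℝ := (r ^ 2)⁻¹ with hc
  have hc0 : 0 < c := by positivity
  have hh := contDiff_ballCutoff
  let K : ℝ → ℝ := fun t => primitive ballCutoff 1 - primitive ballCutoff t
  have hK : ContDiff ℝ ∞ K := contDiff_const.sub (contDiff_primitive hh)
  have hK' (t : ℝ) : deriv K t = -ballCutoff t :=
    ((hasDerivAt_primitive hh.continuous t).const_sub _).deriv
  have hK1 (t : ℝ) (ht : 1 ≤ t) : K t = 0 := by
    simp only [K]
    have := primitive_sub hh.continuous 1 t
    rw [intervalIntegral.integral_congr (g := fun _ => 0), intervalIntegral.integral_zero] at this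
    · linarith
    · intro s hs
      rw [Set.uIcc_of_le ht] at hs
      exact ballCutoff_eq_zero hs.1
  have hK0 (t : ℝ) : 0 ≤ K t := by
    rcases le_total 1 t with ht | ht
    · exact (hK1 t ht).ge
    · exact sub_nonneg.2 (monotone_primitive hh.continuous ballCutoff_nonneg ht)
  have ht1 := tsupport_comp_norm_sq_subset hK1 x₀ hr
  have ht2 := tsupport_comp_norm_sq_subset (fun t => ballCutoff_eq_zero (t := t)) x₀ hr
  have hcs1 : HasCompactSupport fun x : Euc N => K (‖x - x₀‖ ^ 2 * c) :=
    (isCompact_closedBall x₀ r).of_isClosed_subset (isClosed_tsupport _) ht1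
  have hcs2 : HasCompactSupport fun x : Euc N => ballCutoff (‖x - x₀‖ ^ 2 * c) :=
    (isCompact_closedBall x₀ r).of_isClosed_subset (isClosed_tsupport _) ht2
  have key := h.integral_truncation_le hu hg (contDiff_comp_norm_sq hK x₀ c) hcs1 (ht1.trans hU)
    (fun x => hK0 _) (k := fun x => -2 * c * ballCutoff (‖x - x₀‖ ^ 2 * c))
    (contDiff_const.mul (contDiff_comp_norm_sq hh x₀ c))
    hcs2.mul_left ((tsupport_mul_subset_right).trans (ht2.trans hU)) x₀
    (fun x => by
      rw [gradient_comp_norm_sq (hK.differentiable (by simp) _), hK']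
      congr 1
      ring)
  have e : ∀ x : Euc N, truncation (u x) * (N * (-2 * c * ballCutoff (‖x - x₀‖ ^ 2 * c)) +
      ⟪∇ (fun x => -2 * c * ballCutoff (‖x - x₀‖ ^ 2 * c)) x, x - x₀⟫_ℝ) =
      -2 * c * (truncation (u x) * (N * ballCutoff (‖x - x₀‖ ^ 2 * c) +
        2 * (‖x - x₀‖ ^ 2 * c) * deriv ballCutoff (‖x - x₀‖ ^ 2 * c))) := by
    intro x
    have hd : DifferentiableAt ℝ ballCutoff (‖x - x₀‖ ^ 2 * c) := hh.differentiable (by simp) _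
    rw [gradient_comp_norm_sq (H := fun t => -2 * c * ballCutoff t) (hd.const_mul _),
      deriv_const_mul _ hd, inner_smul_left, real_inner_self_eq_norm_sq]
    simp
    ring
  simp only [e, integral_const_mul] at key
  by_contra hneg
  push Not at hneg
  have := mul_pos_of_neg_of_neg (show -2 * c < 0 by linarith) hneg
  linarith

/-! ### The mean value inequality and the strong maximum principle -/

theorem exists_abs_mul_deriv_ballCutoff_le :
    ∃ C, 0 ≤ C ∧ ∀ t, 0 ≤ t → |t * deriv ballCutoff t| ≤ C := by
  have hc : Continuous fun t => t * deriv ballCutoff t :=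
    continuous_id.mul (contDiff_ballCutoff.continuous_deriv (by simp))
  obtain ⟨C, hC⟩ := (isCompact_Icc (a := (0 : ℝ)) (b := 1)).exists_bound_of_continuousOn
    hc.continuousOn
  have hC0 : 0 ≤ C := (norm_nonneg _).trans (hC 0 (by simp))
  refine ⟨C, hC0, fun t ht => ?_⟩
  rcases le_or_gt t 1 with h1 | h1
  · exact hC t ⟨ht, h1⟩
  · rw [deriv_ballCutoff_eq_zero h1, mul_zero, abs_zero]
    exact hC0

theorem integrable_mul_of_bound {s : Set (Euc N)} {v f : Euc N → ℝ} {M R : ℝ} {x₀ : Euc N}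
    (hv : AEStronglyMeasurable v (volume.restrict s)) (hM : ∀ x, |v x| ≤ M)
    (hf : Continuous f) (hf0 : ∀ x, R < ‖x - x₀‖ → f x = 0) :
    Integrable (fun x => v x * f x) (volume.restrict s) := by
  have hfi : Integrable f := hf.integrable_of_hasCompactSupport
    (HasCompactSupport.intro (isCompact_closedBall x₀ R) fun x hx => hf0 x (by
      simpa [dist_eq_norm] using hx))
  exact hfi.restrict.bdd_mul hv (Eventually.of_forall hM)

theorem one_lt_norm_sq_mul_inv {x x₀ : Euc N} {r : ℝ} (hr : 0 < r) (h : r < ‖x - x₀‖) :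
    1 < ‖x - x₀‖ ^ 2 * (r ^ 2)⁻¹ := by
  rw [← div_eq_mul_inv, one_lt_div (by positivity)]
  gcongr

/-- The derivative in the radius of the weighted averages of a bounded function `v` over balls. -/
theorem hasDerivAt_integral_ballCutoff {s : Set (Euc N)} {v : Euc N → ℝ} {M : ℝ} (x₀ : Euc N)
    (hv : AEStronglyMeasurable v (volume.restrict s)) (hM : ∀ x, |v x| ≤ M)
    {r : ℝ} (hr : 0 < r) :
    HasDerivAt (fun r => (r ^ N)⁻¹ *
        ∫ x in s, v x * ballCutoff (‖x - x₀‖ ^ 2 * (r ^ 2)⁻¹))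
      (-((r ^ (N + 1))⁻¹ * ∫ x in s, v x *
        (N * ballCutoff (‖x - x₀‖ ^ 2 * (r ^ 2)⁻¹) + 2 * (‖x - x₀‖ ^ 2 * (r ^ 2)⁻¹) *
          deriv ballCutoff (‖x - x₀‖ ^ 2 * (r ^ 2)⁻¹)))) r := by
  have hM0 : 0 ≤ M := (abs_nonneg _).trans (hM 0)
  obtain ⟨C, hC0, hC⟩ := exists_abs_mul_deriv_ballCutoff_le
  have hh := contDiff_ballCutoff
  have hh' := hh.continuous_deriv (n := ∞) (by simp)
  have hρ (r : ℝ) : Continuous fun x : Euc N => ‖x - x₀‖ ^ 2 * (r ^ 2)⁻¹ := by fun_prop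
  have hint (r : ℝ) (hr : 0 < r) : Integrable
      (fun x => v x * ballCutoff (‖x - x₀‖ ^ 2 * (r ^ 2)⁻¹)) (volume.restrict s) :=
    integrable_mul_of_bound (R := r) (x₀ := x₀) hv hM (hh.continuous.comp (hρ r))
      (fun x hx => ballCutoff_eq_zero (one_lt_norm_sq_mul_inv hr hx).le)
  have hint' (r : ℝ) (hr : 0 < r) : Integrable
      (fun x => v x * ((‖x - x₀‖ ^ 2 * (r ^ 2)⁻¹) *
        deriv ballCutoff (‖x - x₀‖ ^ 2 * (r ^ 2)⁻¹))) (volume.restrict s) :=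
    integrable_mul_of_bound (R := r) (x₀ := x₀) hv hM ((hρ r).mul (hh'.comp (hρ r)))
      (fun x hx => by simp [deriv_ballCutoff_eq_zero (one_lt_norm_sq_mul_inv hr hx)])
  have hder := (hasDerivAt_integral_of_dominated_loc_of_deriv_le
    (μ := volume.restrict s) (x₀ := r) (s := Set.Ioo (r / 2) (2 * r))
    (F := fun r x => v x * ballCutoff (‖x - x₀‖ ^ 2 * (r ^ 2)⁻¹))
    (F' := fun r x => -(2 / r) * (v x * ((‖x - x₀‖ ^ 2 * (r ^ 2)⁻¹) *
      deriv ballCutoff (‖x - x₀‖ ^ 2 * (r ^ 2)⁻¹))))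
    (bound := (Metric.closedBall x₀ (2 * r)).indicator fun _ => 4 / r * (M * C))
    (Ioo_mem_nhds (by linarith) (by linarith))
    (Eventually.of_forall fun t =>
      hv.mul (hh.continuous.comp (hρ t)).aestronglyMeasurable)
    (hint r hr) ((hint' r hr).const_mul _).aestronglyMeasurable
    (Eventually.of_forall fun x t ht => ?_) ?_ (Eventually.of_forall fun x t ht => ?_)).2
  · have hrN : HasDerivAt (fun r : ℝ => (r ^ N)⁻¹) (-(N * r ^ (N - 1)) / (r ^ N) ^ 2) r :=
      (hasDerivAt_pow N r).inv (by positivity)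
    refine (hrN.mul hder).congr_deriv ?_
    have hsplit : (fun x => v x *
        (N * ballCutoff (‖x - x₀‖ ^ 2 * (r ^ 2)⁻¹) + 2 * (‖x - x₀‖ ^ 2 * (r ^ 2)⁻¹) *
          deriv ballCutoff (‖x - x₀‖ ^ 2 * (r ^ 2)⁻¹))) =
        fun x => N * (v x * ballCutoff (‖x - x₀‖ ^ 2 * (r ^ 2)⁻¹)) +
          2 * (v x * ((‖x - x₀‖ ^ 2 * (r ^ 2)⁻¹) *
            deriv ballCutoff (‖x - x₀‖ ^ 2 * (r ^ 2)⁻¹))) := by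
      funext x; ring
    rw [hsplit, integral_add ((hint r hr).const_mul _) ((hint' r hr).const_mul _),
      integral_const_mul, integral_const_mul, integral_const_mul]
    rcases N.eq_zero_or_pos with h0 | h0
    · subst h0
      simp
      field_simp
    · obtain ⟨m, rfl⟩ := Nat.exists_eq_succ_of_ne_zero h0.ne'
      simp only [Nat.succ_eq_add_one, Nat.add_sub_cancel]
      field_simp
      ring
  · have ht0 : 0 < t := by linarith [ht.1]
    by_cases hx : x ∈ Metric.closedBall x₀ (2 * r)
    · rw [Set.indicator_of_mem hx, norm_mul, norm_mul, norm_neg,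
        Real.norm_of_nonneg (by positivity)]
      refine mul_le_mul ?_ (mul_le_mul (hM x) (hC _ (by positivity)) (norm_nonneg _) hM0)
        (by positivity) (by positivity)
      rw [div_le_div_iff₀ ht0 hr]
      linarith [ht.1]
    · have hx' : t < ‖x - x₀‖ := by
        rw [Metric.mem_closedBall, not_le, dist_eq_norm] at hx
        linarith [ht.2]
      rw [Set.indicator_of_notMem hx, deriv_ballCutoff_eq_zero (one_lt_norm_sq_mul_inv ht0 hx')]
      simp
  · exact ((integrable_indicator_iff measurableSet_closedBall).2
      (integrableOn_const (isCompact_closedBall _ _).measure_lt_top.ne)).restrict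
  · have ht0 : 0 < t := by linarith [ht.1]
    have h1 : HasDerivAt (fun t : ℝ => ‖x - x₀‖ ^ 2 * (t ^ 2)⁻¹)
        (‖x - x₀‖ ^ 2 * (-(2 * t) / (t ^ 2) ^ 2)) t := by
      have := ((hasDerivAt_pow 2 t).inv (by positivity)).const_mul (‖x - x₀‖ ^ 2)
      simpa using this
    have h2 := (((hh.differentiable (by simp) _).hasDerivAt.comp t h1).const_mul (v x))
    refine h2.congr_deriv ?_
    field_simp

/-- The mean value property in monotone form: the weighted averages of a superharmonic function
decrease as the radius grows. -/
theorem antitoneOn_integral_ballCutoff {s : Set (Euc N)} {v : Euc N → ℝ} {M R : ℝ} (x₀ : Euc N)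
    (hv : AEStronglyMeasurable v (volume.restrict s)) (hM : ∀ x, |v x| ≤ M)
    (hsup : ∀ r, 0 < r → r ≤ R → 0 ≤ ∫ x in s, v x *
        (N * ballCutoff (‖x - x₀‖ ^ 2 * (r ^ 2)⁻¹) + 2 * (‖x - x₀‖ ^ 2 * (r ^ 2)⁻¹) *
          deriv ballCutoff (‖x - x₀‖ ^ 2 * (r ^ 2)⁻¹))) :
    AntitoneOn (fun r => (r ^ N)⁻¹ *
        ∫ x in s, v x * ballCutoff (‖x - x₀‖ ^ 2 * (r ^ 2)⁻¹)) (Set.Ioc 0 R) := by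
  refine antitoneOn_of_deriv_nonpos (convex_Ioc 0 R) (fun r hr =>
    (hasDerivAt_integral_ballCutoff x₀ hv hM hr.1).continuousAt.continuousWithinAt)
    (fun r hr => ?_) (fun r hr => ?_)
  · rw [interior_Ioc] at hr
    exact (hasDerivAt_integral_ballCutoff x₀ hv hM
      hr.1).differentiableAt.differentiableWithinAt
  · rw [interior_Ioc] at hr
    rw [(hasDerivAt_integral_ballCutoff x₀ hv hM hr.1).deriv]
    have := hsup r hr.1 hr.2.le
    have hr0 := hr.1
    rw [neg_nonpos]
    positivity

/-- At almost every point `x₀`, a number lying below the weighted averages over all small balls is at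
most the value of `v`, up to the volume of the unit ball. -/
theorem ae_integral_ballCutoff_le {U : TopologicalSpace.Opens (Euc N)} {v : Euc N → ℝ} {M : ℝ}
    (hv : AEStronglyMeasurable v (volume.restrict (U : Set (Euc N)))) (hM : ∀ x, |v x| ≤ M)
    (hv0 : ∀ᵐ x ∂volume.restrict (U : Set (Euc N)), 0 ≤ v x) :
    ∀ᵐ x₀ ∂volume.restrict (U : Set (Euc N)), ∀ c, (∀ᶠ r in 𝓝[>] (0 : ℝ), c ≤ (r ^ N)⁻¹ *
        ∫ x in (U : Set (Euc N)), v x * ballCutoff (‖x - x₀‖ ^ 2 * (r ^ 2)⁻¹)) →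
      c ≤ volume.real (Metric.ball (0 : Euc N) 1) * v x₀ := by
  have hUm : MeasurableSet (U : Set (Euc N)) := U.isOpen.measurableSet
  set f : Euc N → ℝ := (U : Set (Euc N)).indicator v with hf
  have hfm : AEStronglyMeasurable f volume := (aestronglyMeasurable_indicator_iff hUm).2 hv
  have hfM (x : Euc N) : ‖f x‖ ≤ M := (norm_indicator_le_norm_self v x).trans (hM x)
  have hfl : LocallyIntegrable f volume :=
    (locallyIntegrable_const M).mono hfm (Eventually.of_forall fun x =>
      (hfM x).trans (le_abs_self M))
  have hf0 : ∀ᵐ x, 0 ≤ f x := by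
    filter_upwards [(ae_restrict_iff' hUm).1 hv0] with x hx
    exact Set.indicator_apply_nonneg hx
  filter_upwards [ae_restrict_of_ae ((Besicovitch.vitaliFamily (volume : Measure
    (Euc N))).ae_tendsto_average hfl), ae_restrict_mem hUm] with x₀ hx₀ hx₀U c hc
  have hlim := (hx₀.comp (Besicovitch.tendsto_filterAt volume x₀)).const_mul
    (volume.real (Metric.ball (0 : Euc N) 1))
  rw [show f x₀ = v x₀ from Set.indicator_of_mem hx₀U v] at hlim
  refine ge_of_tendsto hlim ?_
  filter_upwards [hc, self_mem_nhdsWithin] with r hr hr0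
  have hr0 : 0 < r := hr0
  refine hr.trans ?_
  have hvol : volume.real (Metric.closedBall x₀ r) =
      r ^ N * volume.real (Metric.ball (0 : Euc N) 1) := by
    rw [Measure.addHaar_real_closedBall _ _ hr0.le, finrank_euclideanSpace_fin]
  have hpos : 0 < volume.real (Metric.ball (0 : Euc N) 1) :=
    ENNReal.toReal_pos (Metric.measure_ball_pos _ _ one_pos).ne' measure_ball_lt_top.ne
  simp only [Function.comp_def]
  rw [setAverage_eq, hvol, smul_eq_mul, mul_inv, ← mul_assoc, mul_left_comm,
    mul_inv_cancel₀ hpos.ne', mul_one]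
  gcongr
  rw [← integral_indicator hUm, ← integral_indicator measurableSet_closedBall]
  refine integral_mono_of_nonneg ?_
    ((hfl.integrableOn_isCompact (isCompact_closedBall x₀ r)).integrable_indicator
      measurableSet_closedBall) ?_
  · filter_upwards [hf0] with x hx
    by_cases hxU : x ∈ (U : Set (Euc N))
    · rw [hf, Set.indicator_of_mem hxU] at hx
      simp only [Set.indicator_of_mem hxU]
      exact mul_nonneg hx (ballCutoff_nonneg _)
    · simp [Set.indicator_of_notMem hxU]
  · filter_upwards [hf0] with x hx
    by_cases hxU : x ∈ (U : Set (Euc N))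
    · have hfx : f x = v x := Set.indicator_of_mem hxU v
      rw [hfx] at hx
      simp only [Set.indicator_of_mem hxU]
      by_cases hxr : x ∈ Metric.closedBall x₀ r
      · rw [Set.indicator_of_mem hxr, hfx]
        exact mul_le_of_le_one_right hx (ballCutoff_le_one _)
      · rw [Metric.mem_closedBall, not_le, dist_eq_norm] at hxr
        rw [ballCutoff_eq_zero (one_lt_norm_sq_mul_inv hr0 hxr).le, mul_zero]
        refine Set.indicator_apply_nonneg fun _ => by rw [hfx]; exact hx
    · simp only [Set.indicator_of_notMem hxU]
      exact Set.indicator_apply_nonneg fun _ => hx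

/-- The strong maximum principle: a positive solution of `-Δu = g`, with `g ≥ 0` where `u < 1`, is
bounded away from zero on compact sets. -/
theorem IsWeakPoissonSolution.exists_pos_le {U : TopologicalSpace.Opens (Euc N)}
    {u g : Euc N → ℝ} {G : Euc N → Euc N} (h : IsWeakPoissonSolution U u g G)
    (hu : ∀ᵐ x ∂volume.restrict (U : Set (Euc N)), 0 < u x)
    (hg : ∀ᵐ x ∂volume.restrict (U : Set (Euc N)), u x < 1 → 0 ≤ g x)
    {K : Set (Euc N)} (hK : IsCompact K) (hKU : K ⊆ U) :
    ∃ c, 0 < c ∧ ∀ᵐ x ∂volume.restrict (U : Set (Euc N)), x ∈ K → c ≤ u x := by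
  rcases K.eq_empty_or_nonempty with rfl | hKne
  · exact ⟨1, one_pos, by simp⟩
  obtain ⟨φ, hφ⟩ := h.exists_approx
  have hUm : MeasurableSet (U : Set (Euc N)) := U.isOpen.measurableSet
  obtain ⟨R, hR, hRU⟩ := hK.exists_cthickening_subset_open U.isOpen hKU
  have hball {x : Euc N} (hx : x ∈ K) : Metric.closedBall x R ⊆ Metric.cthickening R K :=
    Metric.closedBall_subset_cthickening hx R
  obtain ⟨M, hM⟩ := exists_abs_truncation_le
  have hM0 : 0 ≤ M := (abs_nonneg _).trans (hM 0)
  have hv : AEStronglyMeasurable (fun x => truncation (u x))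
      (volume.restrict (U : Set (Euc N))) :=
    continuous_truncation.comp_aestronglyMeasurable hφ.aestronglyMeasurable
  have hv0 : ∀ᵐ x ∂volume.restrict (U : Set (Euc N)), 0 < truncation (u x) := by
    filter_upwards [hu] with x hx using truncation_pos hx
  let J : Euc N → ℝ := fun x₀ => ∫ x in (U : Set (Euc N)), truncation (u x) *
    ballCutoff (‖x - x₀‖ ^ 2 * (R ^ 2)⁻¹)
  have hJc : ContinuousOn J K := by
    refine continuousOn_of_dominated
      (bound := (Metric.cthickening R K).indicator fun _ => M) ?_ ?_ ?_ ?_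
    · intro x₀ _
      exact hv.mul (contDiff_ballCutoff.continuous.comp (by fun_prop)).aestronglyMeasurable
    · intro x₀ hx₀
      refine Eventually.of_forall fun x => ?_
      by_cases hx : x ∈ Metric.cthickening R K
      · rw [Set.indicator_of_mem hx, norm_mul, Real.norm_of_nonneg (ballCutoff_nonneg _)]
        exact (mul_le_of_le_one_right (norm_nonneg _) (ballCutoff_le_one _)).trans (hM _)
      · have hx' : R < ‖x - x₀‖ := by
          by_contra hlt
          exact hx (hball hx₀ (by simpa [dist_eq_norm] using hlt))
        rw [Set.indicator_of_notMem hx,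
          ballCutoff_eq_zero (one_lt_norm_sq_mul_inv hR hx').le, mul_zero, norm_zero]
    · exact ((integrable_indicator_iff Metric.isClosed_cthickening.measurableSet).2
        (integrableOn_const (hK.cthickening.measure_lt_top.ne))).restrict
    · refine Eventually.of_forall fun x => Continuous.continuousOn ?_
      exact continuous_const.mul (contDiff_ballCutoff.continuous.comp (by fun_prop))
  have hJpos (x₀ : Euc N) (hx₀ : x₀ ∈ K) : 0 < J x₀ := by
    have hnn : 0 ≤ᵐ[volume.restrict (U : Set (Euc N))] fun x => truncation (u x) *
        ballCutoff (‖x - x₀‖ ^ 2 * (R ^ 2)⁻¹) := by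
      filter_upwards [hv0] with x hx using mul_nonneg hx.le (ballCutoff_nonneg _)
    refine (integral_pos_iff_support_of_nonneg_ae hnn ?_).2 ?_
    · refine integrable_mul_of_bound (R := R) (x₀ := x₀) hv (fun x => hM _)
        (contDiff_ballCutoff.continuous.comp (by fun_prop))
        (fun x hx => ballCutoff_eq_zero (one_lt_norm_sq_mul_inv hR hx).le)
    · have hb : 0 < volume.restrict (U : Set (Euc N)) (Metric.ball x₀ R) := by
        rw [Measure.restrict_apply measurableSet_ball, Set.inter_eq_left.2
          (Metric.ball_subset_closedBall.trans ((hball hx₀).trans hRU))]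
        exact Metric.measure_ball_pos _ _ hR
      refine hb.trans_le (measure_mono_ae ?_)
      filter_upwards [hv0] with x hx hxb
      refine (mul_pos hx (ballCutoff_pos ?_)).ne'
      have hxb : ‖x - x₀‖ < R := by
        rwa [← dist_eq_norm]
      rw [← div_eq_mul_inv, div_lt_one (by positivity)]
      gcongr
  obtain ⟨x₁, hx₁, hmin⟩ := hK.exists_isMinOn hKne hJc
  have hpos : 0 < volume.real (Metric.ball (0 : Euc N) 1) :=
    ENNReal.toReal_pos (Metric.measure_ball_pos _ _ one_pos).ne' measure_ball_lt_top.ne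
  refine ⟨(R ^ N)⁻¹ * J x₁ / volume.real (Metric.ball (0 : Euc N) 1),
    div_pos (mul_pos (by positivity) (hJpos x₁ hx₁)) hpos, ?_⟩
  filter_upwards [ae_integral_ballCutoff_le hv (fun x => hM _) (hv0.mono fun x hx => hx.le), hu]
    with x₀ hx₀ hux hxK
  have hanti := antitoneOn_integral_ballCutoff (R := R) x₀ hv (fun x => hM _)
    (fun r hr hrR => h.integral_truncation_mul_nonneg hu hg hr
      ((Metric.closedBall_subset_closedBall hrR).trans ((hball hxK).trans hRU)))
  have hle := hx₀ ((R ^ N)⁻¹ * J x₀) (by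
    filter_upwards [Ioc_mem_nhdsGT hR] with r hr
    exact hanti hr ⟨hR, le_rfl⟩ hr.2)
  rw [div_le_iff₀ hpos]
  have h1 : (R ^ N)⁻¹ * J x₁ ≤ (R ^ N)⁻¹ * J x₀ := by
    gcongr
    exact hmin hxK
  have h2 := mul_le_mul_of_nonneg_left (truncation_le hux.le) hpos.le
  linarith

/-! ### The comparison principle up to the Hardy constant -/

/-- A cutoff vanishing near the origin removes the singularity of `m`. -/
theorem contDiff_mul_of_zero_notMem_tsupport {ζ m : Euc N → ℝ} (hζ : ContDiff ℝ ∞ ζ)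
    (h0 : (0 : Euc N) ∉ tsupport ζ) (hm : ∀ x, x ≠ 0 → ContDiffAt ℝ ∞ m x) :
    ContDiff ℝ ∞ fun x => ζ x * m x := by
  refine contDiff_iff_contDiffAt.2 fun x => ?_
  rcases eq_or_ne x 0 with rfl | hx
  · refine (contDiffAt_const (c := (0 : ℝ))).congr_of_eventuallyEq ?_
    filter_upwards [notMem_tsupport_iff_eventuallyEq.1 h0] with x hx
    rw [hx, Pi.zero_apply, zero_mul]
  · exact hζ.contDiffAt.mul (hm x hx)

theorem gradient_mul {f g : Euc N → ℝ} {x : Euc N} (hf : DifferentiableAt ℝ f x)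
    (hg : DifferentiableAt ℝ g x) : ∇ (fun x => f x * g x) x = f x • ∇ g x + g x • ∇ f x := by
  have h : HasFDerivAt (fun x => f x * g x) _ x := hf.hasFDerivAt.mul hg.hasFDerivAt
  refine ext_inner_right ℝ fun v => ?_
  rw [inner_gradient_left, h.fderiv]
  simp only [add_apply, smul_apply, smul_eq_mul, inner_add_left, inner_smul_left,
    inner_gradient_left]
  simp

/-- A profile `b` for which `∫ b²`, the factor of the test function, and `∫ b`, the function to which
Hardy's inequality is applied, are close enough for the gain `κ` to absorb the difference. The two
primitives would both be `t` for the non-smooth choice `b = 1` on `(0, ∞)`. -/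
theorem exists_hardy_profile {c κ M : ℝ} (hc : 0 < c) (hκ : 0 < κ) :
    ∃ b : ℝ → ℝ, ContDiff ℝ ∞ b ∧ HasCompactSupport b ∧
      (∀ t, t ≤ 0 → primitive b t = 0 ∧ primitive (fun s => b s ^ 2) t = 0) ∧
      ∀ t, 0 < t → t ≤ M →
        primitive (fun s => b s ^ 2) t * (c * t - κ) - c * primitive b t ^ 2 < 0 := by
  have hd : 0 < κ / (2 * c) := by positivity
  -- `c * d < κ` makes the loss in `t - d ≤ P` smaller than the gain
  set d : ℝ := κ / (2 * c) with hd'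
  have hb := contDiff_plateau 0 d (M + 1)
  have hbc := hb.continuous
  have hb2c : Continuous fun s => plateau 0 d (M + 1) s ^ 2 := hbc.pow 2
  refine ⟨plateau 0 d (M + 1), hb, hasCompactSupport_plateau hd, fun t ht => ?_, fun t ht htM => ?_⟩
  · have hz (s : ℝ) (hs : s ∈ Set.uIcc 0 t) : plateau 0 d (M + 1) s = 0 := by
      rw [Set.uIcc_of_ge ht] at hs
      exact plateau_eq_zero_of_le hd hs.2
    constructor
    · rw [primitive, intervalIntegral.integral_congr (g := fun _ => 0) fun s hs => hz s hs]
      simp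
    · rw [primitive, intervalIntegral.integral_congr (g := fun _ => 0) fun s hs => by
        simp [hz s hs]]
      simp
  · set P := primitive (plateau 0 d (M + 1)) t with hP
    set T := primitive (fun s => plateau 0 d (M + 1) s ^ 2) t with hT
    have hTpos : 0 < T := by
      refine intervalIntegral.intervalIntegral_pos_of_pos_on (hb2c.intervalIntegrable _ _)
        (fun s hs => ?_) ht
      have := plateau_pos hd hs.1 (show s < M + 1 by linarith [hs.2])
      positivity
    have hTP : T ≤ P := by
      refine intervalIntegral.integral_mono_on ht.le (hb2c.intervalIntegrable _ _)
        (hbc.intervalIntegrable _ _) fun s _ => ?_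
      exact pow_le_of_le_one (plateau_nonneg _ _ _ _) (plateau_le_one _ _ _ _) two_ne_zero
    have hPd : t - d ≤ P := by
      rcases le_total t d with htd | htd
      · linarith
      · have h1 := primitive_sub hbc d t
        rw [intervalIntegral.integral_congr (g := fun _ => 1) fun s hs => ?_] at h1
        · have h2 := monotone_primitive hbc (plateau_nonneg 0 d (M + 1)) hd.le
          rw [primitive_zero] at h2
          simp at h1
          linarith
        · rw [Set.uIcc_of_le htd] at hs
          exact plateau_eq_one hd (by linarith [hs.1]) (by linarith [hs.2])
    have hP0 : 0 < P := hTpos.trans_le hTP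
    rcases le_or_gt (c * t - κ) 0 with h1 | h1
    · have := mul_nonpos_of_nonneg_of_nonpos hTpos.le h1
      have : 0 < c * P ^ 2 := by positivity
      linarith
    · have h2 : T * (c * t - κ) ≤ P * (c * t - κ) := by gcongr
      have h3 : c * d = κ / 2 := by rw [hd']; field_simp
      have h4 : c * (t - d) ≤ c * P := by gcongr
      have h5 : P * (c * t - κ) < P * (c * P) := mul_lt_mul_of_pos_left (by linarith) hP0
      nlinarith

theorem IsSmoothApprox.aestronglyMeasurable_comp_sub {U : TopologicalSpace.Opens (Euc N)}
    {u : Euc N → ℝ} {G : Euc N → Euc N} {φ : ℕ → Euc N → ℝ} (h : IsSmoothApprox U u G φ)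
    {S : ℝ → ℝ} (hS : Continuous S) {w : Euc N → ℝ} (hw : Continuous w) :
    AEStronglyMeasurable (fun x => S (w x - u x)) (volume.restrict (U : Set (Euc N))) :=
  hS.comp_aestronglyMeasurable (hw.aestronglyMeasurable.sub h.aestronglyMeasurable)

theorem gradient_inv_norm_sq {x : Euc N} (hx : x ≠ 0) :
    ∇ (fun x : Euc N => (‖x‖ ^ 2)⁻¹) x = (-2 * ((‖x‖ ^ 2)⁻¹) ^ 2) • x := by
  have hx' : ‖x‖ ^ 2 ≠ 0 := by simpa using hx
  have h := gradient_comp_norm_sq (H := fun t => t⁻¹) (x₀ := 0) (x := x) (c := 1)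
    (by simpa using differentiableAt_inv hx')
  simp only [sub_zero, mul_one] at h
  rw [h, deriv_inv]
  simp

theorem contDiffAt_inv_norm_sq {x : Euc N} (hx : x ≠ 0) :
    ContDiffAt ℝ ∞ (fun x : Euc N => (‖x‖ ^ 2)⁻¹) x :=
  (contDiff_id.norm_sq ℝ).contDiffAt.inv (by simpa using hx)

/-- A comparison principle: `w ≤ u` where `ζ ≠ 0`, if `w` is a strict subsolution with respect to
`-Δ - ((N - 2) / 2)² / |x|²` where it exceeds `u`, and `w ≤ u` where the cutoff `ζ` varies.
The gradient of `w` is `m x`, so its Laplacian is `N m + ⟪∇m, x⟫`. -/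
theorem IsWeakPoissonSolution.ae_le_of_subsolution {U : TopologicalSpace.Opens (Euc N)}
    {u g : Euc N → ℝ} {G : Euc N → Euc N} (h : IsWeakPoissonSolution U u g G)
    (hN : 3 ≤ N) (h0 : (0 : Euc N) ∉ U) {ζ w m : Euc N → ℝ} {κ M : ℝ} (hκ : 0 < κ)
    (hζ : ContDiff ℝ ∞ ζ) (hζc : HasCompactSupport ζ) (hζU : tsupport ζ ⊆ U)
    (hζ0 : ∀ x, 0 ≤ ζ x) (hw : ContDiff ℝ ∞ w) (hm : ∀ x, x ≠ 0 → ContDiffAt ℝ ∞ m x)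
    (hwm : ∀ x, ζ x ≠ 0 → ∇ w x = m x • x)
    (hbd : ∀ᵐ x ∂volume.restrict (U : Set (Euc N)), ∇ ζ x ≠ 0 → w x ≤ u x)
    (hM : ∀ᵐ x ∂volume.restrict (U : Set (Euc N)), ζ x ≠ 0 → w x - u x ≤ M)
    (hsub : ∀ᵐ x ∂volume.restrict (U : Set (Euc N)), ζ x ≠ 0 → u x < w x →
      -(N * m x + ⟪∇ m x, x⟫_ℝ) - g x ≤ (hardyConst N * (w x - u x) - κ) / ‖x‖ ^ 2) :
    ∀ᵐ x ∂volume.restrict (U : Set (Euc N)), ζ x ≠ 0 → w x ≤ u x := by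
  have hN' : (3 : ℝ) ≤ N := by exact_mod_cast hN
  have hUm : MeasurableSet (U : Set (Euc N)) := U.isOpen.measurableSet
  set a : ℝ := ((N : ℝ) - 2) / 2 with ha
  have hH : hardyConst N = a ^ 2 := rfl
  have ha0 : 0 < a := by rw [ha]; linarith
  have hζ00 : (0 : Euc N) ∉ tsupport ζ := fun h' => h0 (hζU h')
  obtain ⟨b, hb, hbc, hb0, hbneg⟩ := exists_hardy_profile (M := M) (show 0 < hardyConst N by
    rw [hH]; positivity) hκ
  obtain ⟨φ, hφ⟩ := h.exists_approx
  set P := primitive b with hPdef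
  set T := primitive (fun s => b s ^ 2) with hTdef
  have hb2 : ContDiff ℝ ∞ fun s => b s ^ 2 := hb.pow 2
  have hb2c : HasCompactSupport fun s => b s ^ 2 := by
    refine hbc.mono fun s hs hs' => hs ?_
    simp [hs']
  have hP : ContDiff ℝ ∞ P := contDiff_primitive hb
  have hT : ContDiff ℝ ∞ T := contDiff_primitive hb2
  have hT' : deriv T = fun s => b s ^ 2 := deriv_primitive hb2.continuous
  have hS : ContDiff ℝ ∞ fun t => P t ^ 2 / 2 := (hP.pow 2).div_const 2
  have hS' : deriv (fun t => P t ^ 2 / 2) = fun t => P t * b t := by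
    funext t
    have hd : HasDerivAt (fun t => P t ^ 2 / 2) (_ / 2) t :=
      ((hasDerivAt_primitive hb.continuous t).pow 2).div_const 2
    rw [hd.deriv]
    simp only [Nat.cast_ofNat, Nat.add_one_sub_one, pow_one]
    ring
  obtain ⟨M₁, hM₁⟩ := exists_abs_le_of_hasCompactSupport hb2.continuous hb2c
  obtain ⟨M₂, hM₂⟩ := exists_abs_primitive_le hb2.continuous hb2c
  obtain ⟨M₃, hM₃⟩ := exists_abs_primitive_le hb.continuous hbc
  obtain ⟨M₄, hM₄⟩ := exists_abs_le_of_hasCompactSupport (hP.continuous.mul hb.continuous)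
    (hbc.mul_left (f := P))
  have hM₅ (t : ℝ) : |P t ^ 2 / 2| ≤ M₃ ^ 2 / 2 := by
    rw [abs_div, abs_pow, abs_two]
    have := pow_le_pow_left₀ (abs_nonneg _) (hM₃ t) 2
    gcongr
  have hmζ := contDiff_mul_of_zero_notMem_tsupport hζ hζ00 hm
  have hkζ := contDiff_mul_of_zero_notMem_tsupport hζ hζ00
    (fun x hx => contDiffAt_inv_norm_sq (N := N) hx)
  have hmζc : HasCompactSupport fun x => ζ x * m x := hζc.mul_right
  have hkζc : HasCompactSupport fun x => ζ x * (‖x‖ ^ 2)⁻¹ := hζc.mul_right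
  have e1 := h.integral_comp (M := max M₁ M₂) hζ hζc hζU hw hT
    (fun t => (hM₂ t).trans (le_max_right _ _))
    (fun t => by rw [hT']; exact (hM₁ t).trans (le_max_left _ _))
  have e2 := hφ.integral_deriv_comp_mul (M := max M₁ M₂) hmζ hmζc
    ((tsupport_mul_subset_left).trans hζU) hw hT (fun t => (hM₂ t).trans (le_max_right _ _))
    (fun t => by rw [hT']; exact (hM₁ t).trans (le_max_left _ _)) 0
  have e3 := hφ.integral_deriv_comp_mul (M := max M₄ (M₃ ^ 2 / 2)) hkζ hkζc
    ((tsupport_mul_subset_left).trans hζU) hw hS (fun t => (hM₅ t).trans (le_max_right _ _))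
    (fun t => by rw [hS']; exact (hM₄ t).trans (le_max_left _ _)) 0
  rw [hT'] at e1 e2
  rw [hS'] at e3
  simp only [sub_zero] at e2 e3
  -- measurability and integrability of the terms
  have mT := hφ.aestronglyMeasurable_comp_sub hT.continuous hw.continuous
  have mb2 := hφ.aestronglyMeasurable_comp_sub hb2.continuous hw.continuous
  have mPb := hφ.aestronglyMeasurable_comp_sub (hP.continuous.mul hb.continuous) hw.continuous
  have mS := hφ.aestronglyMeasurable_comp_sub hS.continuous hw.continuous
  have hgw := continuous_gradient hw
  have cmp {k : Euc N → ℝ} (hk : ContDiff ℝ ∞ k) (hkc : HasCompactSupport k) :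
      Integrable (fun x => N * k x + ⟪∇ k x, x⟫_ℝ) (volume.restrict (U : Set (Euc N))) := by
    refine (Continuous.integrable_of_hasCompactSupport ((continuous_const.mul hk.continuous).add
      ((continuous_gradient hk).inner continuous_id)) ?_).restrict
    refine hkc.mono' fun x hx => ?_
    by_contra hx'
    refine hx ?_
    change N * k x + ⟪∇ k x, x⟫_ℝ = 0
    rw [gradient_eq_zero_of_notMem_tsupport k hx', image_eq_zero_of_notMem_tsupport hx',
      inner_zero_left,
      mul_zero, zero_add]
  have cmw {k : Euc N → ℝ} (hk : ContDiff ℝ ∞ k) (hkc : HasCompactSupport k) :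
      Integrable (fun x => k x * ⟪∇ w x, x⟫_ℝ) (volume.restrict (U : Set (Euc N))) :=
    (Continuous.integrable_of_hasCompactSupport (hk.continuous.mul
      (hgw.inner continuous_id)) hkc.mul_right).restrict
  have cmG {k : Euc N → ℝ} (hk : ContDiff ℝ ∞ k) (hkc : HasCompactSupport k) :
      Integrable (fun x => ⟪k x • x, G x⟫_ℝ) (volume.restrict (U : Set (Euc N))) :=
    integrable_inner_of_memLp_two (memLp_of_continuous_of_hasCompactSupport
      (hk.continuous.smul continuous_id) hkc.smul_right _) hφ.memLp
  have j1 : Integrable (fun x => b (w x - u x) ^ 2 * (ζ x * ⟪G x, ∇ w x⟫_ℝ))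
      (volume.restrict (U : Set (Euc N))) := by
    refine Integrable.bdd_mul (c := M₁) ?_ mb2 (Eventually.of_forall fun x => hM₁ _)
    have := integrable_inner_of_memLp_two hφ.memLp (memLp_of_continuous_of_hasCompactSupport
      (V := fun x => ζ x • ∇ w x) (hζ.continuous.smul hgw) hζc.smul_right (U : Set (Euc N)))
    simpa only [inner_smul_right] using this
  have j2 : Integrable (fun x => (b (w x - u x) ^ 2 * ζ x) * ⟪G x, G x⟫_ℝ)
      (volume.restrict (U : Set (Euc N))) := by
    obtain ⟨B, hB⟩ := hζ.continuous.bounded_above_of_compact_support hζc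
    simp only [mul_assoc]
    exact ((integrable_inner_of_memLp_two hφ.memLp hφ.memLp).bdd_mul
      hζ.continuous.aestronglyMeasurable (Eventually.of_forall hB)).bdd_mul (c := M₁) mb2
      (Eventually.of_forall fun x => hM₁ _)
  have j3 := (cmw hmζ hmζc).bdd_mul (c := M₁) mb2 (Eventually.of_forall fun x => hM₁ _)
  have j4 := (cmG hmζ hmζc).bdd_mul (c := M₁) mb2 (Eventually.of_forall fun x => hM₁ _)
  have j5 := (cmw hkζ hkζc).bdd_mul (c := M₄) mPb (Eventually.of_forall fun x => hM₄ _)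
  have j6 := (cmG hkζ hkζc).bdd_mul (c := M₄) mPb (Eventually.of_forall fun x => hM₄ _)
  have j7 := (cmp hmζ hmζc).bdd_mul (c := M₂) mT (Eventually.of_forall fun x => hM₂ _)
  have j8 := (cmp hkζ hkζc).bdd_mul (c := M₃ ^ 2 / 2) mS (Eventually.of_forall fun x => hM₅ _)
  have j9 := (h.locallyIntegrableOn.integrable_mul_of_tsupport_subset hζ.continuous hζc
    hζU).restrict (s := (U : Set (Euc N))) |>.bdd_mul (c := M₂) mT
    (Eventually.of_forall fun x => hM₂ _)
  have j10 := (hkζ.continuous.integrable_of_hasCompactSupport hkζc).restrict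
    (s := (U : Set (Euc N))) |>.bdd_mul (c := M₃ ^ 2 / 2) mS (Eventually.of_forall fun x => hM₅ _)
  have z1 : ∫ x in (U : Set (Euc N)), T (w x - u x) * ⟪G x, ∇ ζ x⟫_ℝ = 0 := by
    refine integral_eq_zero_of_ae ?_
    filter_upwards [hbd] with x hx
    by_cases hx' : ∇ ζ x = 0
    · simp [hx']
    · simp [(hb0 (w x - u x) (by linarith [hx hx'])).2]
  -- the square whose nonnegativity is Hardy's inequality for `P (w - u)`
  have sq : 0 ≤ ∫ x in (U : Set (Euc N)),
      (b (w x - u x) ^ 2 * (ζ x * m x * ⟪∇ w x, x⟫_ℝ) -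
        b (w x - u x) ^ 2 * ⟪(ζ x * m x) • x, G x⟫_ℝ) -
      (b (w x - u x) ^ 2 * (ζ x * ⟪G x, ∇ w x⟫_ℝ) -
        (b (w x - u x) ^ 2 * ζ x) * ⟪G x, G x⟫_ℝ) +
      2 * a * (P (w x - u x) * b (w x - u x) * (ζ x * (‖x‖ ^ 2)⁻¹ * ⟪∇ w x, x⟫_ℝ) -
        P (w x - u x) * b (w x - u x) * ⟪(ζ x * (‖x‖ ^ 2)⁻¹) • x, G x⟫_ℝ) +
      2 * a ^ 2 * (P (w x - u x) ^ 2 / 2 * (ζ x * (‖x‖ ^ 2)⁻¹)) := by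
    refine integral_nonneg_of_ae ?_
    filter_upwards [ae_restrict_mem hUm] with x hxU
    have hx0 : x ≠ 0 := fun hx => h0 (hx ▸ hxU)
    have hxn : ‖x‖ ≠ 0 := norm_ne_zero_iff.2 hx0
    by_cases hζx : ζ x = 0
    · simp [hζx]
    · have hsq : 0 ≤ ζ x * ‖b (w x - u x) • (∇ w x - G x) +
          (a * P (w x - u x) * (‖x‖ ^ 2)⁻¹) • x‖ ^ 2 := mul_nonneg (hζ0 x) (by positivity)
      refine hsq.trans_eq ?_
      rw [← real_inner_self_eq_norm_sq]
      have hw1 : ⟪∇ w x, ∇ w x⟫_ℝ = m x * ⟪∇ w x, x⟫_ℝ := by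
        conv_lhs => rw [hwm x hζx, inner_smul_right, ← hwm x hζx]
      have hw2 : ⟪G x, ∇ w x⟫_ℝ = m x * ⟪x, G x⟫_ℝ := by
        rw [hwm x hζx, inner_smul_right, real_inner_comm]
      simp only [inner_add_left, inner_add_right, inner_smul_left, inner_smul_right,
        inner_sub_left, inner_sub_right, real_inner_comm (G x) (∇ w x), real_inner_comm x (∇ w x),
        real_inner_comm x (G x), hw1, hw2, real_inner_self_eq_norm_sq x, conj_trivial]
      field_simp
      ring
  -- the square after the equation and the divergence theorem have removed all gradients
  set Q : Euc N → ℝ := fun x =>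
    -(T (w x - u x) * (N * (ζ x * m x) + ⟪∇ (fun x => ζ x * m x) x, x⟫_ℝ)) -
      T (w x - u x) * (ζ x * g x) -
      2 * a * (P (w x - u x) ^ 2 / 2 * (N * (ζ x * (‖x‖ ^ 2)⁻¹) +
        ⟪∇ (fun x => ζ x * (‖x‖ ^ 2)⁻¹) x, x⟫_ℝ)) +
      2 * a ^ 2 * (P (w x - u x) ^ 2 / 2 * (ζ x * (‖x‖ ^ 2)⁻¹)) with hQ
  have hQi : Integrable Q (volume.restrict (U : Set (Euc N))) :=
    ((j7.neg.sub j9).sub (j8.const_mul (2 * a))).add (j10.const_mul (2 * a ^ 2))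
  have hQint : 0 ≤ ∫ x in (U : Set (Euc N)), Q x := by
    have i1 := (j3.sub j4).sub (j1.sub j2)
    have i2 := (j5.sub j6).const_mul (2 * a)
    have i3 := (j7.neg.sub j9).sub (j8.const_mul (2 * a))
    rw [integral_add, integral_add, integral_sub, integral_sub, integral_sub,
      integral_const_mul, integral_sub] at sq
    rotate_left
    all_goals first
      | exact j1 | exact j2 | exact j3 | exact j4 | exact j5 | exact j6 | exact j3.sub j4
      | exact j1.sub j2 | exact i1 | exact i2 | exact i1.add i2
      | exact j10.const_mul (2 * a ^ 2) | skip
    rw [hQ, integral_add, integral_sub, integral_sub, integral_neg, integral_const_mul (2 * a)]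
    rotate_left
    all_goals first
      | exact j7.neg | exact j9 | exact j7.neg.sub j9 | exact j8.const_mul (2 * a) | exact i3
      | exact j10.const_mul (2 * a ^ 2) | skip
    rw [z1] at e1
    rw [e3] at sq
    linarith
  -- where `w ≤ u` the integrand vanishes; elsewhere `∇ ζ = 0` and the profile inequality applies
  have hQneg : ∀ᵐ x ∂volume.restrict (U : Set (Euc N)),
      Q x ≤ 0 ∧ (ζ x ≠ 0 → u x < w x → Q x < 0) := by
    filter_upwards [ae_restrict_mem hUm, hbd, hM, hsub] with x hxU hx1 hx2 hx3
    have hx0 : x ≠ 0 := fun hx => h0 (hx ▸ hxU)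
    have hxn : ‖x‖ ≠ 0 := norm_ne_zero_iff.2 hx0
    rcases le_or_gt (w x) (u x) with hwu | hwu
    · obtain ⟨p1, p2⟩ := hb0 (w x - u x) (by linarith)
      have : Q x = 0 := by simp only [hQ, p1, p2]; ring
      exact ⟨this.le, fun _ h' => absurd h' (not_lt.2 hwu)⟩
    · have hg0 : ∇ ζ x = 0 := by
        by_contra hne
        exact absurd (hx1 hne) (not_le.2 hwu)
      have hζd : DifferentiableAt ℝ ζ x := hζ.differentiable (by simp) x
      have hQx : Q x = ζ x * (T (w x - u x) * (-(N * m x + ⟪∇ m x, x⟫_ℝ) - g x) -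
          hardyConst N * P (w x - u x) ^ 2 / ‖x‖ ^ 2) := by
        simp only [hQ]
        rw [gradient_mul hζd ((hm x hx0).differentiableAt (by simp)),
          gradient_mul hζd ((contDiffAt_inv_norm_sq hx0).differentiableAt (by simp)), hg0,
          gradient_inv_norm_sq hx0, hH]
        simp only [smul_zero, add_zero, inner_smul_left, real_inner_self_eq_norm_sq, conj_trivial]
        have hNa : (N : ℝ) = 2 * a + 2 := by rw [ha]; ring
        rw [hNa]
        field_simp
        ring
      by_cases hζx : ζ x = 0
      · simp [hQx, hζx]
      · have hζpos : 0 < ζ x := lt_of_le_of_ne (hζ0 x) (Ne.symm hζx)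
        have hlt : Q x < 0 := by
          have hTn : 0 ≤ T (w x - u x) := by
            have := monotone_primitive hb2.continuous (fun t => sq_nonneg (b t))
              (show 0 ≤ w x - u x by linarith)
            rwa [primitive_zero] at this
          have h1 := mul_le_mul_of_nonneg_left (hx3 hζx hwu) hTn
          have h2 := hbneg (w x - u x) (by linarith) (hx2 hζx)
          have h3 : (T (w x - u x) * (hardyConst N * (w x - u x) - κ) -
              hardyConst N * P (w x - u x) ^ 2) / ‖x‖ ^ 2 < 0 :=
            div_neg_of_neg_of_pos h2 (by positivity)
          rw [hQx]
          refine mul_neg_of_pos_of_neg hζpos ?_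
          rw [sub_div, ← mul_div_assoc'] at h3
          linarith
        exact ⟨hlt.le, fun _ _ => hlt⟩
  have hQn : Integrable (fun x => -Q x) (volume.restrict (U : Set (Euc N))) := hQi.neg
  have hzero : ∫ x in (U : Set (Euc N)), -Q x = 0 := by
    refine le_antisymm ?_ (integral_nonneg_of_ae ?_)
    · rw [integral_neg]; linarith
    · filter_upwards [hQneg] with x hx using neg_nonneg.2 hx.1
  rw [integral_eq_zero_iff_of_nonneg_ae (by
    filter_upwards [hQneg] with x hx using neg_nonneg.2 hx.1) hQn] at hzero
  filter_upwards [hzero, hQneg] with x hx1 hx2 hζx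
  by_contra hne
  have := hx2.2 hζx (not_le.1 hne)
  simp only [Pi.zero_apply, neg_eq_zero] at hx1
  linarith

/-! ### The punctured domain and the radial barrier -/

noncomputable section

/-- The open set `Ω \ {0}`. -/
def puncture (Ω : TopologicalSpace.Opens (Euc N)) : TopologicalSpace.Opens (Euc N) :=
  ⟨(Ω : Set (Euc N)) \ {0}, Ω.isOpen.sdiff isClosed_singleton⟩

end

theorem restrict_puncture (hN : 3 ≤ N) (Ω : TopologicalSpace.Opens (Euc N)) :
    volume.restrict (puncture Ω : Set (Euc N)) = volume.restrict (Ω : Set (Euc N)) := by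
  have : Nonempty (Fin N) := ⟨⟨0, by omega⟩⟩
  exact Measure.restrict_congr_set (sdiff_null_ae_eq_self (measure_singleton 0))

/-- On the punctured domain the right-hand side `μ u / |x|² + u^p - u^q` is locally integrable because
`u` is in `L^(q+1)`, and the integrals in the weak formulation combine into one. -/
theorem IsPositiveWeakSolution.exists_isWeakPoissonSolution (hN : 3 ≤ N)
    {Ω : TopologicalSpace.Opens (Euc N)} {μ p q : ℝ} (hp : 0 < p) (hpq : p < q)
    {u : Euc N → ℝ} (hu : IsPositiveWeakSolution Ω μ p q u) :
    ∃ G, IsWeakPoissonSolution (puncture Ω) u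
      (fun x => μ * (u x / ‖x‖ ^ 2) + (u x ^ p - u x ^ q)) G := by
  obtain ⟨hpos, hLq, G, hG, heq⟩ := hu
  obtain ⟨φ, hφ⟩ := hG.exists_isSmoothApprox
  have hres := restrict_puncture hN Ω
  have hsub : (puncture Ω : Set (Euc N)) ⊆ Ω := Set.sdiff_subset
  have hpow {s : ℝ} (hs0 : 0 < s) (hs : s ≤ q + 1) :
      LocallyIntegrableOn (fun x => u x ^ s) (puncture Ω : Set (Euc N)) := by
    refine (locallyIntegrableOn_iff (puncture Ω).isOpen.isLocallyClosed).2 fun K hKU hK => ?_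
    have : IsFiniteMeasure (volume.restrict K) := ⟨by simpa using hK.measure_lt_top⟩
    have h1 : MemLp u (ENNReal.ofReal (q + 1)) (volume.restrict K) :=
      hLq.mono_measure (Measure.restrict_mono (hKU.trans hsub) le_rfl)
    have h2 : MemLp u (ENNReal.ofReal s) (volume.restrict K) :=
      h1.mono_exponent (ENNReal.ofReal_le_ofReal hs)
    have h3 := h2.integrable_norm_rpow (by simpa using hs0) (by simp)
    rw [ENNReal.toReal_ofReal hs0.le] at h3
    refine h3.congr ?_
    filter_upwards [ae_restrict_of_ae_restrict_of_subset (hKU.trans hsub) hpos] with x hx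
    rw [Real.norm_of_nonneg hx.le]
  have hpoly : LocallyIntegrableOn (fun x => u x ^ p - u x ^ q) (puncture Ω : Set (Euc N)) :=
    (hpow hp (by linarith)).sub (hpow (by linarith) (by linarith))
  have hsing : LocallyIntegrableOn (fun x => u x / ‖x‖ ^ 2) (puncture Ω : Set (Euc N)) := by
    refine (locallyIntegrableOn_iff (puncture Ω).isOpen.isLocallyClosed).2 fun K hKU hK => ?_
    have h1 : IntegrableOn u K := by
      have := (hpow one_pos (by linarith)).integrableOn_compact_subset hKU hK
      simpa using this
    simp only [div_eq_mul_inv]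
    refine h1.mul_continuousOn (ContinuousOn.inv₀ (by fun_prop) fun x hx => ?_) hK
    simpa using (hKU hx).2
  refine ⟨G, ⟨φ, hφ.contDiff, by rw [hres]; exact hφ.ae_tendsto, by rw [hres]; exact hφ.memLp,
    by rw [hres]; exact hφ.tendsto_gradient⟩,
    LocallyIntegrableOn.add (fun x hx => (hsing x hx).smul μ) hpoly, fun ψ => ?_⟩
  have h1 := hsing.integrable_mul_of_tsupport_subset ψ.continuous ψ.hasCompactSupport
    ψ.tsupport_subset
  have h2 := hpoly.integrable_mul_of_tsupport_subset ψ.continuous ψ.hasCompactSupport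
    ψ.tsupport_subset
  let ψ' : 𝓓(Ω, ℝ) := ⟨ψ, ψ.contDiff, ψ.hasCompactSupport, ψ.tsupport_subset.trans hsub⟩
  have key : (∫ x in (Ω : Set (Euc N)), ⟪G x, ∇ ψ x⟫_ℝ) -
      μ * ∫ x in (Ω : Set (Euc N)), u x * ψ x / ‖x‖ ^ 2 =
      ∫ x in (Ω : Set (Euc N)), (u x ^ p - u x ^ q) * ψ x := heq ψ'
  rw [hres, sub_eq_iff_eq_add.1 key, ← integral_const_mul, ← integral_add]
  · refine integral_congr_ae (Eventually.of_forall fun x => ?_)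
    simp only
    ring
  · refine h2.restrict.congr (Eventually.of_forall fun x => mul_comm _ _)
  · refine (h1.restrict.congr (Eventually.of_forall fun x => ?_)).const_mul μ
    simp only
    ring

theorem contDiffAt_norm_sq_rpow (s : ℝ) {x : Euc N} (hx : x ≠ 0) :
    ContDiffAt ℝ ∞ (fun x : Euc N => (‖x‖ ^ 2) ^ s) x :=
  (contDiff_id.norm_sq ℝ).contDiffAt.rpow_const_of_ne (by simpa using hx)

theorem gradient_norm_sq_rpow (s : ℝ) {x : Euc N} (hx : x ≠ 0) :
    ∇ (fun x : Euc N => (‖x‖ ^ 2) ^ s) x = (2 * s * (‖x‖ ^ 2) ^ (s - 1)) • x := by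
  have hx' : ‖x‖ ^ 2 ≠ 0 := by simpa using hx
  have hd := Real.hasDerivAt_rpow_const (x := ‖x‖ ^ 2) (p := s) (Or.inl hx')
  have h := gradient_comp_norm_sq (H := fun t => t ^ s) (x₀ := 0) (x := x) (c := 1)
    (by simpa using hd.differentiableAt)
  simp only [sub_zero, mul_one] at h
  rw [h, hd.deriv, mul_assoc]

theorem gradient_linear_combination {f g : Euc N → ℝ} {x : Euc N} (a b : ℝ)
    (hf : DifferentiableAt ℝ f x) (hg : DifferentiableAt ℝ g x) :
    ∇ (fun x => a * f x + b * g x) x = a • ∇ f x + b • ∇ g x := by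
  have h : HasFDerivAt (fun x => a * f x + b * g x) _ x :=
    (hf.hasFDerivAt.const_mul a).add (hg.hasFDerivAt.const_mul b)
  refine ext_inner_right ℝ fun v => ?_
  rw [inner_gradient_left, h.fderiv]
  simp only [add_apply, smul_apply, smul_eq_mul, inner_add_left, inner_smul_left,
    inner_gradient_left]
  simp

theorem hardyExp_pos {μ : ℝ} (hμ₀ : 0 < μ) (hμ₁ : μ < hardyConst N) : 0 < hardyExp N μ :=
  sub_pos.2 (Real.sqrt_lt_sqrt (by linarith) (by linarith))

theorem sqrt_hardyConst (hN : 3 ≤ N) : √(hardyConst N) = ((N : ℝ) - 2) / 2 := by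
  have hN' : (3 : ℝ) ≤ N := by exact_mod_cast hN
  rw [hardyConst, Real.sqrt_sq (by linarith)]

theorem hardyExp_le (hN : 3 ≤ N) (μ : ℝ) : hardyExp N μ ≤ ((N : ℝ) - 2) / 2 := by
  rw [hardyExp, sqrt_hardyConst hN]
  linarith [Real.sqrt_nonneg (hardyConst N - μ)]

theorem hardyExp_mul (hN : 3 ≤ N) {μ : ℝ} (hμ₁ : μ < hardyConst N) :
    hardyExp N μ * (N - 2 - hardyExp N μ) = μ := by
  have h1 := Real.sq_sqrt (show 0 ≤ hardyConst N - μ by linarith)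
  rw [hardyExp, sqrt_hardyConst hN]
  have h2 : hardyConst N = (((N : ℝ) - 2) / 2) ^ 2 := rfl
  nlinarith

theorem sq_rpow_neg_half {r : ℝ} (hr : 0 ≤ r) (s : ℝ) : (r ^ 2) ^ (-(s / 2)) = r ^ (-s) := by
  rw [← Real.rpow_natCast r 2, ← Real.rpow_mul hr]
  congr 1
  push_cast
  ring

noncomputable section

/-- The factor `m` in `∇w = m x`, where `w` is `radialBarrier α ν C ε`. -/
def radialSlope (α ν C ε : ℝ) (x : Euc N) : ℝ :=
  -(α * C) * (‖x‖ ^ 2) ^ (-(α / 2) - 1) + ε * ν * (‖x‖ ^ 2) ^ (-(ν / 2) - 1)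

/-- The barrier `C |x|^(-α) - ε |x|^(-ν)`. -/
def radialBarrier (α ν C ε : ℝ) (x : Euc N) : ℝ :=
  C * (‖x‖ ^ 2) ^ (-(α / 2)) + -ε * (‖x‖ ^ 2) ^ (-(ν / 2))

end

theorem contDiffAt_radialSlope (α ν C ε : ℝ) {x : Euc N} (hx : x ≠ 0) :
    ContDiffAt ℝ ∞ (radialSlope α ν C ε) x :=
  (contDiffAt_const.mul (contDiffAt_norm_sq_rpow _ hx)).add
    (contDiffAt_const.mul (contDiffAt_norm_sq_rpow _ hx))

theorem contDiffAt_radialBarrier (α ν C ε : ℝ) {x : Euc N} (hx : x ≠ 0) :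
    ContDiffAt ℝ ∞ (radialBarrier α ν C ε) x :=
  (contDiffAt_const.mul (contDiffAt_norm_sq_rpow _ hx)).add
    (contDiffAt_const.mul (contDiffAt_norm_sq_rpow _ hx))

theorem gradient_radialBarrier (α ν C ε : ℝ) {x : Euc N} (hx : x ≠ 0) :
    ∇ (radialBarrier α ν C ε) x = radialSlope α ν C ε x • x := by
  have h := gradient_linear_combination C (-ε)
    ((contDiffAt_norm_sq_rpow (-(α / 2)) hx).differentiableAt (by simp))
    ((contDiffAt_norm_sq_rpow (-(ν / 2)) hx).differentiableAt (by simp))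
  rw [gradient_norm_sq_rpow _ hx, gradient_norm_sq_rpow _ hx, smul_smul, smul_smul,
    ← add_smul] at h
  refine h.trans ?_
  rw [radialSlope]
  congr 1
  ring

/-- The negative Laplacian of the barrier: `|x|^(-s)` is multiplied by `s (N - 2 - s) / |x|²`. -/
theorem laplacian_radialBarrier (α ν C ε : ℝ) {x : Euc N} (hx : x ≠ 0) :
    -(N * radialSlope α ν C ε x + ⟪∇ (radialSlope α ν C ε) x, x⟫_ℝ) =
      (α * (N - 2 - α) * (C * (‖x‖ ^ 2) ^ (-(α / 2))) -
        ν * (N - 2 - ν) * (ε * (‖x‖ ^ 2) ^ (-(ν / 2)))) / ‖x‖ ^ 2 := by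
  have hx' : 0 < ‖x‖ ^ 2 := by positivity
  have h := gradient_linear_combination (-(α * C)) (ε * ν)
    ((contDiffAt_norm_sq_rpow (-(α / 2) - 1) hx).differentiableAt (by simp))
    ((contDiffAt_norm_sq_rpow (-(ν / 2) - 1) hx).differentiableAt (by simp))
  rw [gradient_norm_sq_rpow _ hx, gradient_norm_sq_rpow _ hx, smul_smul, smul_smul,
    ← add_smul] at h
  change ∇ (radialSlope α ν C ε) x = _ at h
  rw [h, inner_smul_left, real_inner_self_eq_norm_sq, radialSlope]
  simp only [Real.rpow_sub_one hx'.ne', conj_trivial]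
  field_simp
  ring

/-- An inequality that holds almost everywhere in an open set holds at the points of continuity. -/
theorem MeasureTheory.ae_le_of_continuousAt {s : Set (Euc N)} (hs : IsOpen s) {f w : Euc N → ℝ}
    (h : ∀ᵐ x ∂volume.restrict s, f x ≤ w x) {x : Euc N} (hx : x ∈ s) (hf : ContinuousAt f x)
    (hw : ContinuousAt w x) : f x ≤ w x := by
  have hd := Measure.dense_of_ae ((ae_restrict_iff' hs.measurableSet).1 h)
  have hfr : ∃ᶠ y in 𝓝 x, f y ≤ w y :=
    ((mem_closure_iff_frequently.1 (hd x)).and_eventually (hs.mem_nhds hx)).mono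
      fun y hy => hy.1 hy.2
  exact le_of_tendsto_of_tendsto_of_frequently hf hw hfr

/-! ### The lower bound near the origin -/

noncomputable section

/-- A smooth cutoff vanishing for `‖x‖² ≤ a / 2` and equal to `1` for `a ≤ ‖x‖²`. -/
def outerCutoff (a : ℝ) (x : Euc N) : ℝ := Real.smoothTransition (2 * ‖x‖ ^ 2 / a - 1)

/-- A smooth cutoff equal to `1` for `‖x‖² ≤ a` and vanishing for `2 a ≤ ‖x‖²`. -/
def innerCutoff (a : ℝ) (x : Euc N) : ℝ := Real.smoothTransition (2 - ‖x‖ ^ 2 / a)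

end

theorem contDiff_outerCutoff (a : ℝ) : ContDiff ℝ ∞ (outerCutoff (N := N) a) :=
  Real.smoothTransition.contDiff.comp
    (((contDiff_const.mul (contDiff_id.norm_sq ℝ)).div_const a).sub contDiff_const)

theorem contDiff_innerCutoff (a : ℝ) : ContDiff ℝ ∞ (innerCutoff (N := N) a) :=
  Real.smoothTransition.contDiff.comp
    (contDiff_const.sub ((contDiff_id.norm_sq ℝ).div_const a))

theorem outerCutoff_eq_zero {a : ℝ} (ha : 0 < a) {x : Euc N} (hx : ‖x‖ ^ 2 ≤ a / 2) :
    outerCutoff a x = 0 := by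
  refine Real.smoothTransition.zero_of_nonpos ?_
  rw [sub_nonpos, div_le_one ha]
  linarith

theorem outerCutoff_eq_one {a : ℝ} (ha : 0 < a) {x : Euc N} (hx : a ≤ ‖x‖ ^ 2) :
    outerCutoff a x = 1 := by
  refine Real.smoothTransition.one_of_one_le ?_
  rw [le_sub_iff_add_le, le_div_iff₀ ha]
  linarith

theorem innerCutoff_eq_zero {a : ℝ} (ha : 0 < a) {x : Euc N} (hx : 2 * a ≤ ‖x‖ ^ 2) :
    innerCutoff a x = 0 := by
  refine Real.smoothTransition.zero_of_nonpos ?_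
  rw [sub_nonpos, le_div_iff₀ ha]
  linarith

theorem innerCutoff_eq_one {a : ℝ} (ha : 0 < a) {x : Euc N} (hx : ‖x‖ ^ 2 ≤ a) :
    innerCutoff a x = 1 := by
  refine Real.smoothTransition.one_of_one_le ?_
  have : ‖x‖ ^ 2 / a ≤ 1 := (div_le_one ha).2 hx
  linarith

theorem tsupport_outerCutoff_subset {a : ℝ} (ha : 0 < a) :
    tsupport (outerCutoff (N := N) a) ⊆ {x | a / 2 ≤ ‖x‖ ^ 2} := by
  refine closure_minimal (fun x hx => ?_) (isClosed_le continuous_const (by fun_prop))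
  by_contra hx'
  exact hx (outerCutoff_eq_zero ha (not_le.1 hx').le)

theorem tsupport_innerCutoff_subset {a : ℝ} (ha : 0 < a) :
    tsupport (innerCutoff (N := N) a) ⊆ {x | ‖x‖ ^ 2 ≤ 2 * a} := by
  refine closure_minimal (fun x hx => ?_) (isClosed_le (by fun_prop) continuous_const)
  by_contra hx'
  exact hx (innerCutoff_eq_zero ha (not_le.1 hx').le)

/-- Where the barrier `w` exceeds `t = u x`, the quantity `-Δw - g` is controlled by the Hardy
potential applied to `w - t`, with a strict gain: this is the subsolution inequality that
`IsWeakPoissonSolution.ae_le_of_subsolution` asks for. -/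
theorem radialBarrier_subsolution (hN : 3 ≤ N) {μ p q α C ε R : ℝ} (hμ₁ : μ < hardyConst N)
    (hα : 0 < α) (hαq : α * q = α + 2)
    (hC : 0 < C) (hCκ : C ^ (q - 1) ≤ (μ - α * (N - 2 - α)) / 2)
    (hκ : 0 < μ - α * (N - 2 - α)) (hε : 0 < ε) (hq : 1 < q) {x : Euc N} (hx : x ≠ 0)
    (hxR : ‖x‖ ^ 2 ≤ R) {t : ℝ} (ht : 0 < t)
    (htw : t < radialBarrier α (hardyExp N μ) C ε x) :
    -(N * radialSlope α (hardyExp N μ) C ε x +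
        ⟪∇ (radialSlope α (hardyExp N μ) C ε) x, x⟫_ℝ) -
        (μ * (t / ‖x‖ ^ 2) + (t ^ p - t ^ q)) ≤
      (hardyConst N * (radialBarrier α (hardyExp N μ) C ε x - t) -
        (μ - α * (N - 2 - α)) / 2 * (C * R ^ (-(α / 2)))) / ‖x‖ ^ 2 := by
  have hx2 : 0 < ‖x‖ ^ 2 := by positivity
  rw [laplacian_radialBarrier _ _ _ _ hx, hardyExp_mul hN hμ₁]
  set κ := μ - α * (N - 2 - α) with hκdef
  set A := (‖x‖ ^ 2) ^ (-(α / 2)) with hA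
  set B := (‖x‖ ^ 2) ^ (-(hardyExp N μ / 2)) with hB
  have hA0 : 0 < A := Real.rpow_pos_of_pos hx2 _
  have hB0 : 0 < B := Real.rpow_pos_of_pos hx2 _
  have hw : radialBarrier α (hardyExp N μ) C ε x = C * A + -ε * B := rfl
  rw [hw] at htw ⊢
  have htA : t ≤ C * A := by
    have : 0 < ε * B := mul_pos hε hB0
    linarith
  -- the exponent is critical: `A ^ q = A / ‖x‖ ^ 2`
  have hAq : A ^ q = A / ‖x‖ ^ 2 := by
    rw [hA, ← Real.rpow_mul hx2.le, ← Real.rpow_sub_one hx2.ne']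
    congr 1
    linarith
  have htq : t ^ q ≤ κ / 2 * (C * A) / ‖x‖ ^ 2 := by
    calc t ^ q ≤ (C * A) ^ q := Real.rpow_le_rpow ht.le htA (by linarith)
      _ = C ^ (q - 1) * C * (A / ‖x‖ ^ 2) := by
        rw [Real.mul_rpow hC.le hA0.le, hAq, ← Real.rpow_add_one hC.ne', sub_add_cancel]
      _ ≤ κ / 2 * C * (A / ‖x‖ ^ 2) := by gcongr
      _ = κ / 2 * (C * A) / ‖x‖ ^ 2 := by ring
  have hRA : R ^ (-(α / 2)) ≤ A := Real.rpow_le_rpow_of_nonpos hx2 hxR (by linarith)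
  have htp : 0 ≤ t ^ p := Real.rpow_nonneg ht.le p
  have h1 : (α * (N - 2 - α) * (C * A) - μ * (ε * B)) / ‖x‖ ^ 2 -
      (μ * (t / ‖x‖ ^ 2) + (t ^ p - t ^ q)) ≤
      (α * (N - 2 - α) * (C * A) - μ * (ε * B) - μ * t + κ / 2 * (C * A)) / ‖x‖ ^ 2 := by
    have : (α * (N - 2 - α) * (C * A) - μ * (ε * B) - μ * t + κ / 2 * (C * A)) / ‖x‖ ^ 2 =
      (α * (N - 2 - α) * (C * A) - μ * (ε * B)) / ‖x‖ ^ 2 - μ * (t / ‖x‖ ^ 2) +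
        κ / 2 * (C * A) / ‖x‖ ^ 2 := by ring
    rw [this]
    linarith
  refine h1.trans ?_
  gcongr
  have h2 : κ / 2 * (C * R ^ (-(α / 2))) ≤ κ / 2 * (C * A) := by gcongr
  have h3 : μ * (C * A + -ε * B - t) ≤ hardyConst N * (C * A + -ε * B - t) := by
    have : 0 ≤ C * A + -ε * B - t := by linarith
    gcongr
  have h4 : α * (N - 2 - α) = μ - κ := by rw [hκdef]; ring
  rw [h4]
  linarith

/-- Comparison of `u` with the barrier in a ball, given a lower bound `c` for `u` on the shell
`R ≤ |x| ≤ 2 R` that dominates the barrier there. -/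
theorem IsWeakPoissonSolution.ae_radialBarrier_le (hN : 3 ≤ N)
    {Ω : TopologicalSpace.Opens (Euc N)} {μ p q α C ε R c : ℝ} {u : Euc N → ℝ}
    {G : Euc N → Euc N}
    (h : IsWeakPoissonSolution (puncture Ω) u
      (fun x => μ * (u x / ‖x‖ ^ 2) + (u x ^ p - u x ^ q)) G)
    (hu : ∀ᵐ x ∂volume.restrict (puncture Ω : Set (Euc N)), 0 < u x)
    (hμ₁ : μ < hardyConst N) (hα : 0 < α) (hαν : α < hardyExp N μ) (hαq : α * q = α + 2)
    (hC : 0 < C) (hCκ : C ^ (q - 1) ≤ (μ - α * (N - 2 - α)) / 2)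
    (hκ : 0 < μ - α * (N - 2 - α)) (hε : 0 < ε) (hq : 1 < q) (hR : 0 < R)
    (hRΩ : Metric.closedBall (0 : Euc N) (2 * R) ⊆ Ω)
    (hc : ∀ᵐ x ∂volume.restrict (puncture Ω : Set (Euc N)), R ≤ ‖x‖ → ‖x‖ ≤ 2 * R → c ≤ u x)
    (hCc : C * R ^ (-α) ≤ c) :
    ∀ᵐ x ∂volume.restrict (puncture Ω : Set (Euc N)),
      ‖x‖ < R → radialBarrier α (hardyExp N μ) C ε x ≤ u x := by
  set ν := hardyExp N μ with hν
  set r : ℝ := min (R / 2) ((ε / C) ^ (ν - α)⁻¹) with hr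
  have hr0 : 0 < r := lt_min (by positivity) (Real.rpow_pos_of_pos (by positivity) _)
  have hrR : r < R := (min_le_left _ _).trans_lt (by linarith)
  have hr2 : 0 < r ^ 2 := by positivity
  have hr4 : 0 < r ^ 2 / 4 := by positivity
  have hR2 : 0 < R ^ 2 := by positivity
  -- near the origin the singular term with exponent `ν` dominates
  have hneg (x : Euc N) (hx : x ≠ 0) (hxr : ‖x‖ ≤ r) : radialBarrier α ν C ε x ≤ 0 := by
    have hx0 : 0 < ‖x‖ := norm_pos_iff.2 hx
    have h1 : ‖x‖ ^ (ν - α) ≤ ε / C := by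
      calc ‖x‖ ^ (ν - α) ≤ ((ε / C) ^ (ν - α)⁻¹) ^ (ν - α) :=
            Real.rpow_le_rpow hx0.le (hxr.trans (min_le_right _ _)) (by linarith)
        _ = ε / C := Real.rpow_inv_rpow (by positivity) (by linarith)
    rw [radialBarrier, sq_rpow_neg_half hx0.le, sq_rpow_neg_half hx0.le]
    have h2 : ‖x‖ ^ (-α) = ‖x‖ ^ (ν - α) * ‖x‖ ^ (-ν) := by
      rw [← Real.rpow_add hx0]; congr 1; ring
    have h3 : C * ‖x‖ ^ (-α) ≤ ε * ‖x‖ ^ (-ν) := by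
      rw [h2, ← mul_assoc]
      have := (le_div_iff₀' hC).1 h1
      gcongr
    linarith
  let ζ : Euc N → ℝ := fun x => outerCutoff (r ^ 2) x * innerCutoff (R ^ 2) x
  -- the cutoff in `w` only makes it smooth at the origin; it is `1` near the support of `ζ`
  let w : Euc N → ℝ := fun x => outerCutoff (r ^ 2 / 4) x * radialBarrier α ν C ε x
  have hζt : tsupport ζ ⊆ {x | r ^ 2 / 2 ≤ ‖x‖ ^ 2} ∩ {x | ‖x‖ ^ 2 ≤ 2 * R ^ 2} :=
    Set.subset_inter ((tsupport_mul_subset_left).trans (tsupport_outerCutoff_subset hr2))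
      ((tsupport_mul_subset_right).trans (tsupport_innerCutoff_subset hR2))
  have hζball : tsupport ζ ⊆ Metric.closedBall 0 (2 * R) := by
    intro x hx
    rw [mem_closedBall_zero_iff]
    have : ‖x‖ ^ 2 ≤ 2 * R ^ 2 := (hζt hx).2
    exact abs_le_of_sq_le_sq' (by nlinarith) (by positivity) |>.2
  have hζU : tsupport ζ ⊆ puncture Ω := fun x hx => by
    refine ⟨hRΩ (hζball hx), fun hx0 => ?_⟩
    have h1 : r ^ 2 / 2 ≤ ‖x‖ ^ 2 := (hζt hx).1
    rw [Set.mem_singleton_iff.1 hx0, norm_zero] at h1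
    linarith
  have hζx {x : Euc N} (hx : ζ x ≠ 0) : r ^ 2 / 2 < ‖x‖ ^ 2 ∧ ‖x‖ ^ 2 ≤ 2 * R ^ 2 := by
    refine ⟨?_, (hζt (subset_tsupport ζ hx)).2⟩
    by_contra hle
    exact hx (by simp only [ζ]; rw [outerCutoff_eq_zero hr2 (not_lt.1 hle), zero_mul])
  have hw1 {x : Euc N} (hx : r ^ 2 / 4 ≤ ‖x‖ ^ 2) : w x = radialBarrier α ν C ε x := by
    simp only [w]
    rw [outerCutoff_eq_one hr4 hx, one_mul]
  have hwC {x : Euc N} : w x ≤ C * (‖x‖ ^ 2) ^ (-(α / 2)) := by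
    have h1 : radialBarrier α ν C ε x ≤ C * (‖x‖ ^ 2) ^ (-(α / 2)) := by
      have : 0 ≤ ε * (‖x‖ ^ 2) ^ (-(ν / 2)) := by positivity
      rw [radialBarrier]
      linarith
    have h2 : 0 ≤ C * (‖x‖ ^ 2) ^ (-(α / 2)) := by positivity
    calc w x ≤ outerCutoff (r ^ 2 / 4) x * (C * (‖x‖ ^ 2) ^ (-(α / 2))) :=
          mul_le_mul_of_nonneg_left h1 (Real.smoothTransition.nonneg _)
      _ ≤ _ := mul_le_of_le_one_left h2 (Real.smoothTransition.le_one _)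
  have key := h.ae_le_of_subsolution hN (fun h' => h'.2 rfl) (ζ := ζ) (w := w)
    (m := radialSlope α ν C ε)
    (κ := (μ - α * (N - 2 - α)) / 2 * (C * (2 * R ^ 2) ^ (-(α / 2))))
    (M := C * (r ^ 2 / 2) ^ (-(α / 2))) (by positivity)
    ((contDiff_outerCutoff _).mul (contDiff_innerCutoff _))
    ((isCompact_closedBall _ _).of_isClosed_subset (isClosed_tsupport _) hζball) hζU
    (fun x => mul_nonneg (Real.smoothTransition.nonneg _) (Real.smoothTransition.nonneg _))
    (contDiff_mul_of_zero_notMem_tsupport (contDiff_outerCutoff _) (fun h' => by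
      have := tsupport_outerCutoff_subset hr4 h'
      rw [Set.mem_ofPred_eq, norm_zero] at this
      linarith) fun x hx => contDiffAt_radialBarrier α ν C ε hx)
    (fun x hx => contDiffAt_radialSlope α ν C ε hx) (fun x hx => ?_) ?_ ?_ ?_
  · filter_upwards [key, hu, self_mem_ae_restrict (puncture Ω).isOpen.measurableSet]
      with x hx1 hx2 hxU hxR
    rcases le_or_gt ‖x‖ r with hxr | hxr
    · exact (hneg x hxU.2 hxr).trans hx2.le
    · rw [← hw1 (by nlinarith)]
      refine hx1 ?_
      simp only [ζ]
      rw [outerCutoff_eq_one hr2 (by gcongr), innerCutoff_eq_one hR2 (by gcongr)]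
      norm_num
  · have hx' := (hζx hx).1
    have hx0 : x ≠ 0 := by
      rintro rfl
      rw [norm_zero] at hx'
      linarith
    have hev : w =ᶠ[𝓝 x] radialBarrier α ν C ε := by
      have : ∀ᶠ y : Euc N in 𝓝 x, r ^ 2 / 4 < ‖y‖ ^ 2 :=
        (show Continuous fun y : Euc N => ‖y‖ ^ 2 by fun_prop).continuousAt.eventually
          (lt_mem_nhds (by linarith))
      filter_upwards [this] with y hy using hw1 hy.le
    rw [← gradient_radialBarrier α ν C ε hx0, gradient, gradient, hev.fderiv_eq]
  · filter_upwards [hu, hc, self_mem_ae_restrict (puncture Ω).isOpen.measurableSet]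
      with x hx1 hx2 hxU hgx
    rcases le_or_gt ‖x‖ r with hxr | hxr
    · exact (mul_nonpos_of_nonneg_of_nonpos (Real.smoothTransition.nonneg _)
        (hneg x hxU.2 hxr)).trans hx1.le
    · rcases lt_or_ge ‖x‖ R with hxR | hxR
      · refine absurd ?_ hgx
        have hev : ζ =ᶠ[𝓝 x] fun _ => 1 := by
          filter_upwards [continuous_norm.continuousAt.eventually (lt_mem_nhds hxr),
            continuous_norm.continuousAt.eventually (gt_mem_nhds hxR)] with y hy1 hy2
          simp only [ζ]
          rw [outerCutoff_eq_one hr2 (by gcongr), innerCutoff_eq_one hR2 (by gcongr), one_mul]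
        rw [gradient, hev.fderiv_eq]
        simp
      · have hx2R : ‖x‖ ≤ 2 * R := by
          by_contra hlt
          exact hgx (gradient_eq_zero_of_notMem_tsupport ζ fun h' =>
            hlt (by simpa using hζball h'))
        refine hwC.trans (le_trans ?_ (hx2 hxR hx2R))
        rw [sq_rpow_neg_half (norm_nonneg _)]
        refine le_trans ?_ hCc
        gcongr ?_ * ?_
        exact Real.rpow_le_rpow_of_nonpos hR hxR (by linarith)
  · filter_upwards [hu] with x hx1 hζ0
    have h1 : (‖x‖ ^ 2) ^ (-(α / 2)) ≤ (r ^ 2 / 2) ^ (-(α / 2)) :=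
      Real.rpow_le_rpow_of_nonpos (by positivity) (hζx hζ0).1.le (by linarith)
    have h2 := mul_le_mul_of_nonneg_left h1 hC.le
    have := hwC (x := x)
    linarith
  · filter_upwards [hu, self_mem_ae_restrict (puncture Ω).isOpen.measurableSet]
      with x hx1 hxU hζ0 hlt
    have hwx := hw1 (x := x) (by linarith [(hζx hζ0).1])
    rw [hwx] at hlt ⊢
    exact radialBarrier_subsolution hN hμ₁ hα hαq hC hCκ hκ hε hq hxU.2 (hζx hζ0).2 hx1 hlt

theorem theoremt (N : ℕ) (hN : 3 ≤ N)
    (Ω : TopologicalSpace.Opens (EuclideanSpace ℝ (Fin N))) (hΩ : (0 : EuclideanSpace ℝ (Fin N)) ∈ Ω)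
    (μ : ℝ) (hμ₀ : 0 < μ) (hμ₁ : μ < hardyConst N)
    (p q : ℝ) (hp : ((N : ℝ) + 2) / ((N : ℝ) - 2) ≤ p)
    (hq : max p ((2 + hardyExp N μ) / hardyExp N μ) < q)
    (u : EuclideanSpace ℝ (Fin N) → ℝ) (hu : IsPositiveWeakSolution Ω μ p q u) :
    ∃ C : ℝ, 0 < C ∧ ∃ R : ℝ, 0 < R ∧
      Metric.ball (0 : EuclideanSpace ℝ (Fin N)) R ⊆ (Ω : Set (EuclideanSpace ℝ (Fin N))) ∧
      (∀ᵐ x ∂volume.restrict (Metric.ball (0 : EuclideanSpace ℝ (Fin N)) R),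
        C * ‖x‖ ^ (-(2 / (q - 1))) ≤ u x) ∧
      (∀ w : EuclideanSpace ℝ (Fin N) → ℝ,
        w =ᵐ[volume.restrict (Ω : Set (EuclideanSpace ℝ (Fin N)))] u →
        ∀ x ∈ Metric.ball (0 : EuclideanSpace ℝ (Fin N)) R, x ≠ 0 → ContinuousAt w x →
          C * ‖x‖ ^ (-(2 / (q - 1))) ≤ w x) := by
  have hN' : (3 : ℝ) ≤ N := by exact_mod_cast hN
  have hν := hardyExp_pos hμ₀ hμ₁
  have hνle := hardyExp_le hN μ
  have hνμ := hardyExp_mul hN hμ₁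
  set ν := hardyExp N μ with hνdef
  have hp1 : 1 < p := lt_of_lt_of_le ((one_lt_div (by linarith)).2 (by linarith)) hp
  have hpq : p < q := (le_max_left _ _).trans_lt hq
  have hq1 : 1 < q := hp1.trans hpq
  set α : ℝ := 2 / (q - 1) with hα
  have hα0 : 0 < α := div_pos two_pos (by linarith)
  have hαq : α * q = α + 2 := by
    rw [hα]
    field_simp [show q - 1 ≠ 0 by linarith]
    ring
  have hαν : α < ν := by
    have h1 : (2 + ν) / ν < q := (le_max_right _ _).trans_lt hq
    rw [div_lt_iff₀ hν] at h1
    rw [hα, div_lt_iff₀ (by linarith)]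
    linarith
  have hκ : 0 < μ - α * (N - 2 - α) := by
    have : 0 < (ν - α) * (N - 2 - ν - α) := mul_pos (by linarith) (by linarith)
    nlinarith
  obtain ⟨G, hG⟩ := hu.exists_isWeakPoissonSolution hN (by linarith) hpq
  have hres := restrict_puncture hN Ω
  have hpos : ∀ᵐ x ∂volume.restrict (puncture Ω : Set (Euc N)), 0 < u x := by
    rw [hres]
    exact hu.1
  obtain ⟨R₀, hR₀, hR₀Ω⟩ := Metric.isOpen_iff.1 Ω.isOpen 0 hΩ
  obtain ⟨R, hR, hRΩ⟩ : ∃ R, 0 < R ∧ Metric.closedBall (0 : Euc N) (2 * R) ⊆ Ω :=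
    ⟨R₀ / 4, by positivity,
      (Metric.closedBall_subset_ball (by linarith)).trans hR₀Ω⟩
  have hgpos : ∀ᵐ x ∂volume.restrict (puncture Ω : Set (Euc N)), u x < 1 →
      0 ≤ μ * (u x / ‖x‖ ^ 2) + (u x ^ p - u x ^ q) := by
    filter_upwards [hpos] with x hx hx1
    have h1 := Real.rpow_le_rpow_of_exponent_ge hx hx1.le hpq.le
    have h2 : 0 ≤ μ * (u x / ‖x‖ ^ 2) := by positivity
    linarith
  have hKc : IsCompact {x : Euc N | R ≤ ‖x‖ ∧ ‖x‖ ≤ 2 * R} := by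
    refine (isCompact_closedBall (0 : Euc N) (2 * R)).of_isClosed_subset
      ((isClosed_le continuous_const continuous_norm).inter
        (isClosed_le continuous_norm continuous_const)) fun x hx => ?_
    simpa using hx.2
  obtain ⟨c, hc0, hc⟩ := hG.exists_pos_le hpos hgpos hKc fun x hx =>
    ⟨hRΩ (by simpa using hx.2), fun hx0 => by
      have := hx.1
      rw [Set.mem_singleton_iff.1 hx0, norm_zero] at this
      linarith⟩
  obtain ⟨C, hC, hCc, hCκ⟩ : ∃ C, 0 < C ∧ C * R ^ (-α) ≤ c ∧
      C ^ (q - 1) ≤ (μ - α * (N - 2 - α)) / 2 := by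
    have hRα : 0 < R ^ (-α) := Real.rpow_pos_of_pos hR _
    refine ⟨min (c / R ^ (-α)) (((μ - α * (N - 2 - α)) / 2) ^ (q - 1)⁻¹),
      lt_min (by positivity) (Real.rpow_pos_of_pos (by positivity) _),
      (le_div_iff₀ hRα).1 (min_le_left _ _), ?_⟩
    calc _ ≤ (((μ - α * (N - 2 - α)) / 2) ^ (q - 1)⁻¹) ^ (q - 1) :=
          Real.rpow_le_rpow (le_min (by positivity) (by positivity)) (min_le_right _ _)
            (by linarith)
      _ = _ := Real.rpow_inv_rpow (by positivity) (by linarith)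
  have hbarrier : ∀ᵐ x ∂volume.restrict (puncture Ω : Set (Euc N)), ∀ n : ℕ,
      ‖x‖ < R → radialBarrier α ν C (1 / ((n : ℝ) + 1)) x ≤ u x :=
    ae_all_iff.2 fun n => hG.ae_radialBarrier_le hN hpos hμ₁ hα0 hαν hαq hC hCκ hκ
      (by positivity) hq1 hR hRΩ (by
        filter_upwards [hc] with x hx h1 h2 using hx ⟨h1, h2⟩) hCc
  have hballΩ : Metric.ball (0 : Euc N) R ⊆ Ω :=
    (Metric.ball_subset_closedBall.trans (Metric.closedBall_subset_closedBall (by linarith))).trans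
      hRΩ
  have hae : ∀ᵐ x ∂volume.restrict (Metric.ball (0 : Euc N) R), C * ‖x‖ ^ (-α) ≤ u x := by
    rw [hres] at hbarrier
    filter_upwards [ae_restrict_of_ae_restrict_of_subset hballΩ hbarrier,
      ae_restrict_mem measurableSet_ball] with x hx hxR
    have hlim : Tendsto (fun n : ℕ => radialBarrier α ν C (1 / ((n : ℝ) + 1)) x) atTop
        (𝓝 (C * (‖x‖ ^ 2) ^ (-(α / 2)) + -0 * (‖x‖ ^ 2) ^ (-(ν / 2)))) :=
      tendsto_const_nhds.add (tendsto_one_div_add_atTop_nhds_zero_nat.neg.mul_const _)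
    rw [neg_zero, zero_mul, add_zero, sq_rpow_neg_half (norm_nonneg _)] at hlim
    exact le_of_tendsto hlim (Eventually.of_forall fun n => hx n (by simpa using hxR))
  refine ⟨C, hC, R, hR, hballΩ, hae, fun w hw x hx hx0 hwx => ?_⟩
  refine MeasureTheory.ae_le_of_continuousAt (f := fun x => C * ‖x‖ ^ (-α)) Metric.isOpen_ball ?_
    hx ?_ hwx
  · filter_upwards [hae, ae_restrict_of_ae_restrict_of_subset hballΩ hw] with y hy1 hy2
    rw [hy2]
    exact hy1
  · exact continuousAt_const.mul
      (continuous_norm.continuousAt.rpow_const (Or.inl (norm_ne_zero_iff.2 hx0)))
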